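/- Scalar products are linear in the first argument, $\mathcal B(\cdot,\cdot)$ denotes bounded operators, and continuity and derivatives with respect to $t\in[0,1]$ (one-sided at $0$ and $1$; a dot denotes the derivative) are taken in operator norm. **Setting.** Let $\mathcal H,\mathfrak H$ be complex Hilbert spaces and $A$ a densely defined closed symmetric operator in $\mathcal H$. Let $\mathcal H_+=\operatorname{dom}(A^*)$ with the graph scalar product, and let $\mathcal D\supset\operatorname{dom}(A)$ be a dense subspace of $\mathcal H_+$ that is a Banach space continuously embedded in $\mathcal H_+$. Put $J=\begin{bmatrix}0&I\\-I&0\end{bmatrix}$ on $\mathfrak H\times\mathfrak H$ and $\omega((f_1,f_2),(g_1,g_2))=\langle f_2,g_1\rangle-\langle f_1,g_2\rangle$; a subspace $\mathcal F\subset\mathfrak H\times\mathfrak H$ is Lagrangian if $\mathcal F=\{f:\omega(f,g)=0\ \forall g\in\mathcal F\}$. For each $t\in[0,1]$ let the following be given: * $T_t=[\Gamma_{0,t},\Gamma_{1,t}]^\top\in\mathcal B(\mathcal D,\mathfrak H\times\mathfrak H)$ with dense range and $\langle A^*u,v\rangle-\langle u,A^*v\rangle=\omega(T_tu,T_tv)$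 for all $u,v\in\mathcal D$; * an orthogonal projection $Q_t$ in $\mathfrak H\times\mathfrak H$ with Lagrangian range, and operators $X_t,Y_t\in\mathcal B(\mathfrak H)$ with $X_tY_t^*=Y_tX_t^*$, with $\begin{bmatrix}X_t&Y_t\\-Y_t&X_t\end{bmatrix}$ boundedly invertible (so that $X_tX_t^*+Y_tY_t^*$ is invertible), and with $\operatorname{ran}Q_t=\ker[X_t,Y_t]=\{(f_1,f_2):X_tf_1+Y_tf_2=0\}$; * a self-adjoint extension $\mathcal A_t$ of $A$ with $\operatorname{dom}(\mathcal A_t)\subset\mathcal D$ and $\overline{T_t(\operatorname{dom}\mathcal A_t)}=\operatorname{ran}Q_t$; * a self-adjoint $V_t\in\mathcal B(\mathcal H)$. Let $H_t=\mathcal A_t+V_t$ and $R_t(\zeta)=(H_t-\zeta)^{-1}$ for $\zeta\notin\operatorname{Spec}(H_t)$; then $R_t(\zeta)\in\mathcal B(\mathcal H,\mathcal D)$, so $T_tR_t(\zeta)\in\mathcal B(\mathcal H,\mathfrak H\times\mathfrak H)$. Put $$W(X,Y)=(XX^*+YY^*)^{-1}[-Y,X],\qquad Z_{t,s}=W(X_t,Y_t)^*(X_tY_s^*-Y_tX_s^*)W(X_s,Y_s).$$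 **Theorem.** (1) (Krein formula) For all $s,t\in[0,1]$ and $\zeta\notin\operatorname{Spec}(H_t)\cup\operatorname{Spec}(H_s)$, $$R_t(\zeta)-R_s(\zeta)=R_t(\zeta)(V_s-V_t)R_s(\zeta)+(T_tR_t(\overline\zeta))^*Z_{t,s}T_sR_s(\zeta)+(T_tR_t(\overline\zeta))^*J(T_t-T_s)R_s(\zeta).$$ Let $t_0\in[0,1]$. (2) (Continuity) Suppose that $\|(\mathcal A_t-\mathbf i)^{-1}\|_{\mathcal B(\mathcal H,\mathcal D)}=O(1)$ as $t\to t_0$ and that $t\mapsto T_t,V_t,X_t,Y_t$ are continuous at $t_0$. Then for every $\zeta_0\notin\operatorname{Spec}(H_{t_0})$ one has $\zeta_0\notin\operatorname{Spec}(H_t)$ for $t$ near $t_0$, and $t\mapsto R_t(\zeta_0)\in\mathcal B(\mathcal H)$ is continuous at $t_0$. Suppose from now on that $\|(\mathcal A_t-\mathbf i)^{-1}-(\mathcal A_{t_0}-\mathbf i)^{-1}\|_{\mathcal B(\mathcal H,\mathcal D)}=o(1)$ as $t\to t_0$ and that $t\mapsto T_t,V_t,X_t,Y_t$ are differentiable at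 $t_0$. (3) (Riccati equation) For every $\zeta_0\notin\operatorname{Spec}(H_{t_0})$ one has $\zeta_0\notin\operatorname{Spec}(H_t)$ for $t$ near $t_0$, the function $t\mapsto R_t(\zeta_0)\in\mathcal B(\mathcal H)$ is differentiable at $t_0$, and, with $W=W(X_{t_0},Y_{t_0})$, $$\dot R_{t_0}(\zeta_0)=-R_{t_0}(\zeta_0)\dot V_{t_0}R_{t_0}(\zeta_0)+(T_{t_0}R_{t_0}(\overline{\zeta_0}))^*W^*(\dot X_{t_0}Y_{t_0}^*-\dot Y_{t_0}X_{t_0}^*)W\,T_{t_0}R_{t_0}(\zeta_0)+(T_{t_0}R_{t_0}(\overline{\zeta_0}))^*J\dot T_{t_0}R_{t_0}(\zeta_0).$$ (4) (Hadamard formula) Let $\lambda\in\mathbb R$ be an isolated point of $\operatorname{Spec}(H_{t_0})$ that is an eigenvalue of finite multiplicity $m\ge1$. Then there are an orthonormal family $u_1,\dots,u_m\in\ker(H_{t_0}-\lambda)$ and real functions $\lambda_1(t),\dots,\lambda_m(t)$ with $\lambda_j(t_0)=\lambda$ that label the eigenvalues of $H_t$ near $\lambda$ for $t$ near $t_0$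 (whenever $\lambda$ is the only point of $\operatorname{Spec}(H_{t_0})$ in a closed disc about $\lambda$, then, for $t$ near $t_0$, the part of $\operatorname{Spec}(H_t)$ in the open disc consists of the eigenvalues $\lambda_1(t),\dots,\lambda_m(t)$, repeated according to multiplicity), are differentiable at $t_0$, and satisfy $$\dot\lambda_j(t_0)=\langle\dot V_{t_0}u_j,u_j\rangle+\langle(X_{t_0}\dot Y_{t_0}^*-Y_{t_0}\dot X_{t_0}^*)\phi_j,\phi_j\rangle+\omega(T_{t_0}u_j,\dot T_{t_0}u_j),$$ where $\phi_j=W(X_{t_0},Y_{t_0})T_{t_0}u_j$; equivalently, $\phi_j$ is the unique vector of $\mathfrak H$ with $\Gamma_{0,t_0}u_j=-Y_{t_0}^*\phi_j$ and $\Gamma_{1,t_0}u_j=X_{t_0}^*\phi_j$. -/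

import Mathlib

open Filter Topology
open scoped InnerProduct

noncomputable section

namespace BdryFamily

section Boundary

variable {K E : Type*} [NormedAddCommGroup K] [InnerProductSpace ℂ K]
  [NormedAddCommGroup E] [NormedSpace ℂ E]

/-- The Hilbert space `K × K` of boundary data, with the `ℓ²` direct sum scalar product. -/
abbrev Pair (K : Type*) := WithLp 2 (K × K)

/-- The row operator `[A, B] : K × K → E`, `(f₁, f₂) ↦ A f₁ + B f₂`. -/
def row (A B : K →L[ℂ] E) : Pair K →L[ℂ] E :=
  A ∘L WithLp.fstL 2 ℂ K K + B ∘L WithLp.sndL 2 ℂ K K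

/-- The column operator `[A, B]ᵀ : E → K × K`, `h ↦ (A h, B h)`. -/
def col (A B : E →L[ℂ] K) : E →L[ℂ] Pair K :=
  ((WithLp.prodContinuousLinearEquiv 2 ℂ K K).symm : K × K →L[ℂ] Pair K) ∘L A.prod B

/-- The block operator `J = [[0, I], [-I, 0]]`. -/
def opJ (K : Type*) [NormedAddCommGroup K] [InnerProductSpace ℂ K] : Pair K →L[ℂ] Pair K :=
  col (WithLp.sndL 2 ℂ K K) (-WithLp.fstL 2 ℂ K K)

/-- The symplectic form `ω((f₁, f₂), (g₁, g₂)) = ⟨f₂, g₁⟩ - ⟨f₁, g₂⟩`, where `⟨·, ·⟩` is linear in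
its first argument. Mathlib's `inner ℂ x y` is linear in the second one, so that `⟨x, y⟩` is
`inner ℂ y x`. -/
def omega (f g : Pair K) : ℂ := inner ℂ g.fst f.snd - inner ℂ g.snd f.fst

/-- A subspace is Lagrangian if it equals its annihilator with respect to `ω`. -/
def IsLagrangian (F : Submodule ℂ (Pair K)) : Prop :=
  (F : Set (Pair K)) = {f | ∀ g ∈ F, omega f g = 0}

/-- The block operator `M^{X,Y} = [[X, Y], [-Y, X]]`. -/
def opM (X Y : K →L[ℂ] K) : Pair K →L[ℂ] Pair K := col (row X Y) (row (-Y) X)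

/-- `W(X, Y) = (X X* + Y Y*)⁻¹ [-Y, X]`. -/
def opW [CompleteSpace K] (X Y : K →L[ℂ] K) : Pair K →L[ℂ] K :=
  Ring.inverse (X ∘L X† + Y ∘L Y†) ∘L row (-Y) X

/-- `Z_{2,1} = W(X₂, Y₂)* (X₂ Y₁* - Y₂ X₁*) W(X₁, Y₁)`. -/
def opZ [CompleteSpace K] (X₂ Y₂ X₁ Y₁ : K →L[ℂ] K) : Pair K →L[ℂ] Pair K :=
  (opW X₂ Y₂)† ∘L (X₂ ∘L Y₁† - Y₂ ∘L X₁†) ∘L opW X₁ Y₁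

end Boundary

section Unbounded

variable {H : Type*} [NormedAddCommGroup H] [InnerProductSpace ℂ H]

/-- `R` is the bounded two-sided inverse of `B - ζ`. -/
def IsResolvent (B : H →ₗ.[ℂ] H) (ζ : ℂ) (R : H →L[ℂ] H) : Prop :=
  (∀ v : H, ∃ h : R v ∈ B.domain, B ⟨R v, h⟩ - ζ • R v = v) ∧
    ∀ x : B.domain, R (B x - ζ • (x : H)) = x

/-- The resolvent set of an unbounded operator. -/
def resolvSet (B : H →ₗ.[ℂ] H) : Set ℂ := {ζ | ∃ R, IsResolvent B ζ R}

/-- The spectrum of an unbounded operator. -/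
def spec (B : H →ₗ.[ℂ] H) : Set ℂ := (resolvSet B)ᶜ

open scoped Classical in
/-- The resolvent `(B - ζ)⁻¹` as a bounded operator (and `0` if `ζ` is in the spectrum). -/
def resolv (B : H →ₗ.[ℂ] H) (ζ : ℂ) : H →L[ℂ] H :=
  if h : ∃ R, IsResolvent B ζ R then h.choose else 0

/-- The eigenspace `ker (B - μ)`, as a subspace of the Hilbert space. -/
def eigSpace (B : H →ₗ.[ℂ] H) (μ : ℂ) : Submodule ℂ H where
  carrier := {x | ∃ h : x ∈ B.domain, B ⟨x, h⟩ = μ • x}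
  zero_mem' := ⟨B.domain.zero_mem, (LinearPMap.map_zero B).trans (smul_zero μ).symm⟩
  add_mem' := by
    rintro x y ⟨hx, hx1⟩ ⟨hy, hy1⟩
    refine ⟨B.domain.add_mem hx hy, ?_⟩
    rw [smul_add, ← hx1, ← hy1]
    exact LinearPMap.map_add B ⟨x, hx⟩ ⟨y, hy⟩
  smul_mem' := by
    rintro c x ⟨hx, hx1⟩
    refine ⟨B.domain.smul_mem c hx, ?_⟩
    rw [smul_comm, ← hx1]
    exact LinearPMap.map_smul B c ⟨x, hx⟩

/-- The sum `B + V` of an unbounded operator and a bounded one, on the domain of `B`. -/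
def addBdd (B : H →ₗ.[ℂ] H) (V : H →L[ℂ] H) : H →ₗ.[ℂ] H := (V : H →ₗ[ℂ] H) +ᵥ B

theorem resolv_spec {B : H →ₗ.[ℂ] H} {ζ : ℂ} (h : ζ ∈ resolvSet B) :
    IsResolvent B ζ (resolv B ζ) := by
  have h1 : ∃ R, IsResolvent B ζ R := h
  rw [resolv, dif_pos h1]
  exact h1.choose_spec

variable [CompleteSpace H]

/-- The graph `{(u, A* u)}` of the adjoint `A*`, as a subspace of the Hilbert sum `H ⊕ H`. -/
def graphSub (A : H →ₗ.[ℂ] H) : Submodule ℂ (WithLp 2 (H × H)) :=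
  A.adjoint.graph.comap (WithLp.linearEquiv 2 ℂ (H × H)).toLinearMap

/-- The space `H₊ = dom A*` with the graph scalar product `⟨u, v⟩ + ⟨A* u, A* v⟩`; the element `u`
of `dom A*` is represented by the pair `(u, A* u)`. -/
abbrev HPlus (A : H →ₗ.[ℂ] H) := ↥(graphSub A)

/-- The inclusion of `H₊` into `H`. -/
def inclPlus (A : H →ₗ.[ℂ] H) : HPlus A →L[ℂ] H :=
  WithLp.fstL 2 ℂ H H ∘L (graphSub A).subtypeL

/-- The operator `A*` on `H₊`. -/
def adjPlus (A : H →ₗ.[ℂ] H) : HPlus A →L[ℂ] H :=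
  WithLp.sndL 2 ℂ H H ∘L (graphSub A).subtypeL

theorem adjPlus_eq (A : H →ₗ.[ℂ] H) (u : HPlus A) :
    ∃ h : inclPlus A u ∈ A.adjoint.domain, A.adjoint ⟨inclPlus A u, h⟩ = adjPlus A u := by
  have h1 := u.2
  simp only [graphSub, Submodule.mem_comap, LinearPMap.mem_graph_iff] at h1
  obtain ⟨y, hy1, hy2⟩ := h1
  refine ⟨?_, ?_⟩
  · have : inclPlus A u = (y : H) := hy1.symm
    rw [this]; exact y.2
  · have e : (⟨inclPlus A u, (show inclPlus A u = (y : H) from hy1.symm) ▸ y.2⟩ :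
        A.adjoint.domain) = y := Subtype.ext hy1.symm
    rw [e]
    exact hy2

variable {D : Type*} [NormedAddCommGroup D] [NormedSpace ℂ D]

/-- The inclusion of the trace domain `D` into `H`, given its inclusion `j` into `H₊`. -/
def emb {A : H →ₗ.[ℂ] H} (j : D →L[ℂ] HPlus A) : D →L[ℂ] H := inclPlus A ∘L j

open scoped Classical in
/-- The resolvent `(B - ζ)⁻¹` regarded as a bounded operator from `H` to `D`. -/
def resolvD {A : H →ₗ.[ℂ] H} (j : D →L[ℂ] HPlus A) (B : H →ₗ.[ℂ] H) (ζ : ℂ) : H →L[ℂ] D :=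
  if h : ∃ S : H →L[ℂ] D, ∀ v, emb j (S v) = resolv B ζ v then h.choose else 0

/-- If `dom B ⊆ D` and `ζ` is not in the spectrum of `B`, then `resolvD` really is the resolvent:
it is a bounded operator from `H` to `D` by the closed graph theorem. -/
theorem resolvD_spec [CompleteSpace D] {A : H →ₗ.[ℂ] H} {j : D →L[ℂ] HPlus A}
    (hj : Function.Injective j) {B : H →ₗ.[ℂ] H}
    (hB : ∀ x ∈ B.domain, ∃ d : D, emb j d = x) {ζ : ℂ} (hζ : ζ ∈ resolvSet B) (v : H) :
    emb j (resolvD j B ζ v) = resolv B ζ v := by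
  have hinj : Function.Injective (emb j) := by
    intro a b hab
    apply hj
    obtain ⟨ha, ha'⟩ := adjPlus_eq A (j a)
    obtain ⟨hb, hb'⟩ := adjPlus_eq A (j b)
    have h1 : inclPlus A (j a) = inclPlus A (j b) := hab
    have h2 : adjPlus A (j a) = adjPlus A (j b) := by
      rw [← ha', ← hb']
      congr 2
    apply Subtype.ext
    apply (WithLp.equiv 2 (H × H)).injective
    exact Prod.ext h1 h2
  have hR : ∀ v, ∃ d : D, emb j d = resolv B ζ v := fun v =>
    hB _ ((resolv_spec hζ).1 v).1
  choose s hs using hR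
  let S : H →ₗ[ℂ] D :=
    { toFun := s
      map_add' := fun x y => hinj (by simp [hs])
      map_smul' := fun c x => hinj (by simp [hs]) }
  have hS : ∀ v, emb j (S v) = resolv B ζ v := hs
  have hc : IsClosed (S.graph : Set (H × D)) := by
    have : (S.graph : Set (H × D)) = {p | emb j p.2 = resolv B ζ p.1} := by
      ext p
      simp only [SetLike.mem_coe, LinearMap.mem_graph_iff, Set.mem_ofPred_eq]
      exact ⟨fun h => by rw [h, hS], fun h => hinj (by rw [h, hS])⟩
    rw [this]
    exact isClosed_eq (by fun_prop) (by fun_prop)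
  have hex : ∃ S : H →L[ℂ] D, ∀ v, emb j (S v) = resolv B ζ v :=
    ⟨⟨S, S.continuous_of_isClosed_graph hc⟩, hS⟩
  rw [resolvD, dif_pos hex]
  exact hex.choose_spec v

end Unbounded

section Hypotheses

variable {H K D : Type*}
  [NormedAddCommGroup H] [InnerProductSpace ℂ H] [CompleteSpace H]
  [NormedAddCommGroup K] [InnerProductSpace ℂ K] [CompleteSpace K]
  [NormedAddCommGroup D] [NormedSpace ℂ D]

/-- `A` is a densely defined closed symmetric operator, and the Banach space `D` is (through the
bounded injection `j`) a dense subspace of `H₊` that contains `dom A`. -/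
structure IsTraceDomain (A : H →ₗ.[ℂ] H) (j : D →L[ℂ] HPlus A) : Prop where
  dense_domain : Dense (A.domain : Set H)
  closed : A.IsClosed
  symmetric : A.IsFormalAdjoint A
  injective : Function.Injective j
  dense_range : DenseRange j
  domain_le : ∀ x ∈ A.domain, ∃ d : D, emb j d = x

/-- `T = [Γ₀, Γ₁]ᵀ` is a trace operator: it has dense range and satisfies the Green identity
`⟨A* u, v⟩ - ⟨u, A* v⟩ = ω(T u, T v)` (scalar products linear in the first argument). -/
structure IsTraceOperator {A : H →ₗ.[ℂ] H} (j : D →L[ℂ] HPlus A) (T : D →L[ℂ] Pair K) : Prop where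
  dense_range : DenseRange T
  green : ∀ u v : D,
    inner ℂ (emb j v) (adjPlus A (j u)) - inner ℂ (adjPlus A (j v)) (emb j u) = omega (T u) (T v)

/-- The hypotheses on the families `T_t`, `Q_t`, `𝒜_t`, `V_t`, `t ∈ [0, 1]`. -/
structure IsFamily {A : H →ₗ.[ℂ] H} (j : D →L[ℂ] HPlus A) (T : ℝ → D →L[ℂ] Pair K)
    (Q : ℝ → Pair K →L[ℂ] Pair K) (𝒜 : ℝ → H →ₗ.[ℂ] H) (V : ℝ → H →L[ℂ] H) : Prop where
  traceDomain : IsTraceDomain A j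
  traceOp : ∀ t ∈ Set.Icc (0 : ℝ) 1, IsTraceOperator j (T t)
  proj : ∀ t ∈ Set.Icc (0 : ℝ) 1, IsStarProjection (Q t)
  lagrangian : ∀ t ∈ Set.Icc (0 : ℝ) 1, IsLagrangian (LinearMap.range (Q t).toLinearMap)
  selfAdjoint : ∀ t ∈ Set.Icc (0 : ℝ) 1, IsSelfAdjoint (𝒜 t)
  extends_A : ∀ t ∈ Set.Icc (0 : ℝ) 1, A ≤ 𝒜 t
  domain_sub : ∀ t ∈ Set.Icc (0 : ℝ) 1, ∀ x ∈ (𝒜 t).domain, ∃ d : D, emb j d = x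
  closure_trace : ∀ t ∈ Set.Icc (0 : ℝ) 1,
    closure (T t '' {d : D | emb j d ∈ (𝒜 t).domain}) = LinearMap.range (Q t).toLinearMap
  selfAdjoint_V : ∀ t ∈ Set.Icc (0 : ℝ) 1, IsSelfAdjoint (V t)

/-- The Lagrangian planes are `ran Q_t = ker [X_t, Y_t]`, where `X_t Y_t* = Y_t X_t*` and
`0` is not in the spectrum of `M^{X_t, Y_t}`. -/
structure IsKernelFamily (Q : ℝ → Pair K →L[ℂ] Pair K) (X Y : ℝ → K →L[ℂ] K) : Prop where
  range_eq : ∀ t ∈ Set.Icc (0 : ℝ) 1,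
    LinearMap.range (Q t).toLinearMap = LinearMap.ker (row (X t) (Y t)).toLinearMap
  comm : ∀ t ∈ Set.Icc (0 : ℝ) 1, X t ∘L (Y t)† = Y t ∘L (X t)†
  invertible : ∀ t ∈ Set.Icc (0 : ℝ) 1, (0 : ℂ) ∉ spectrum ℂ (opM (X t) (Y t))

/-- `f : [0, 1] → F` is continuous at `t₀` (in the norm of `F`). -/
def Continuous01 {F : Type*} [NormedAddCommGroup F] (f : ℝ → F) (t₀ : ℝ) : Prop :=
  ContinuousWithinAt f (Set.Icc 0 1) t₀

/-- `f : [0, 1] → F` is differentiable at `t₀` with derivative `f'` (in the norm of `F`). -/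
def HasDeriv01 {F : Type*} [NormedAddCommGroup F] [NormedSpace ℂ F] (f : ℝ → F) (f' : F)
    (t₀ : ℝ) : Prop :=
  HasDerivWithinAt f f' (Set.Icc 0 1) t₀

/-- `‖(𝒜_t - i)⁻¹‖_{B(H, D)} = O(1)` as `t → t₀` in `[0, 1]`. -/
def ResolventBounded {A : H →ₗ.[ℂ] H} (j : D →L[ℂ] HPlus A) (𝒜 : ℝ → H →ₗ.[ℂ] H) (t₀ : ℝ) : Prop :=
  (fun t => resolvD j (𝒜 t) Complex.I) =O[𝓝[Set.Icc 0 1] t₀] fun _ => (1 : ℝ)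

/-- `‖(𝒜_t - i)⁻¹ - (𝒜_{t₀} - i)⁻¹‖_{B(H, D)} = o(1)` as `t → t₀` in `[0, 1]`. -/
def ResolventContinuous {A : H →ₗ.[ℂ] H} (j : D →L[ℂ] HPlus A) (𝒜 : ℝ → H →ₗ.[ℂ] H)
    (t₀ : ℝ) : Prop :=
  (fun t => resolvD j (𝒜 t) Complex.I - resolvD j (𝒜 t₀) Complex.I)
    =o[𝓝[Set.Icc 0 1] t₀] fun _ => (1 : ℝ)

/-- `lam 1, …, lam m` label the eigenvalues of `B t` near `lam₀` for `t ∈ [0, 1]` near `t₀`: if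
`lam₀` is the only point of the spectrum of `B t₀` in a closed disc about `lam₀`, then for `t`
near `t₀` the spectrum of `B t` in the open disc is `{lam 1 t, …, lam m t}`, every eigenvalue
being listed as often as its multiplicity says. -/
def LabelsEigenvalues (B : ℝ → H →ₗ.[ℂ] H) (t₀ lam₀ : ℝ) {m : ℕ} (lam : Fin m → ℝ → ℝ) : Prop :=
  (∀ k, lam k t₀ = lam₀) ∧
  ∀ r : ℝ, 0 < r → Metric.closedBall (lam₀ : ℂ) r ∩ spec (B t₀) = {(lam₀ : ℂ)} →
    ∀ᶠ t in 𝓝[Set.Icc 0 1] t₀,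
      spec (B t) ∩ Metric.ball (lam₀ : ℂ) r = Set.range (fun k => (lam k t : ℂ)) ∧
      ∀ μ ∈ Metric.ball (lam₀ : ℂ) r,
        Module.finrank ℂ (eigSpace (B t) μ) = Nat.card {k : Fin m // (lam k t : ℂ) = μ}

end Hypotheses

end BdryFamily

end

/-! Krein's formula is Green's identity read through the resolvents. Pair the difference of
resolvents with a vector `k`, and put `u = R_s(ζ) h` and `v = R_t(ζ̄) k`, both of which lie in `D`.
Since `A*` acts on `u` and `v` as `𝒜_s` and `𝒜_t`, the boundary form `ω(T_t u, T_t v)` equals the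
difference of resolvents up to the potential term. It splits as `ω(T_s u, T_t v) + ω((T_t - T_s) u,
T_t v)`. In the first summand both entries lie in Lagrangian planes, where a vector has the form
`(-Y* φ, X* φ)` with `φ = W f`, and this produces `Z` (`inner_opZ`); the second is the `J` term.

Take `s = t₀`. Every term on the right is then a product with a factor that vanishes at `t = t₀`:
`V_{t₀} - V_t`, `X_t Y_{t₀}* - Y_t X_{t₀}*` or `T_t - T_{t₀}`. If the factors to its left stay
bounded, the resolvents converge. If they converge, the product is differentiable as soon as the
vanishing factor is (`hasDerivWithinAt_comp_of_eq_zero`), which is why no derivative of `(𝒜_t -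
i)⁻¹` in `D` is needed. Convergence is first obtained off the real axis, where `‖R_t(ζ)‖ ≤ |Im
ζ|⁻¹`, and then carried to every `ζ` by `R(ζ) = R(c) (1 - (ζ - c) R(c))⁻¹`.

For the eigenvalues, fix a real `c` in the resolvent set and study the bounded self-adjoint family
`G(t) = R_t(c)`, differentiable at `t₀`, near its eigenvalue `(λ - c)⁻¹`. A continuous cutoff of
`G(t)` is a spectral projection of constant finite rank that depends continuously on `t` at `t₀`.
Eigenvectors of `G(t)` in its range have limits along ultrafilters, and the difference quotients of
the eigenvalues then tend to eigenvalues of the compression of `G'(t₀)` to the eigenspace. Sorting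
the quotients makes these limits independent of the ultrafilter. The substitution `λ_k = c + γ_k⁻¹`
and the Riccati equation give Hadamard's formula. -/

namespace BdryFamily

/-! ### Spectral projections from the continuous functional calculus -/

section SpectralCutoff

/-- A continuous cutoff, equal to `1` for `|x - g| ≤ δ` and to `0` for `2 δ ≤ |x - g|`. -/
noncomputable def cutoff (g δ x : ℝ) : ℝ := max 0 (min 1 (2 - |x - g| / δ))

theorem continuous_cutoff (g δ : ℝ) : Continuous (cutoff g δ) := by
  unfold cutoff; fun_prop

theorem cutoff_eq_one {g δ x : ℝ} (hδ : 0 < δ) (h : |x - g| < δ) : cutoff g δ x = 1 := by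
  have : |x - g| / δ ≤ 1 := by rw [div_le_one hδ]; exact h.le
  rw [cutoff, min_eq_left (by linarith), max_eq_right zero_le_one]

theorem cutoff_eq_zero {g δ x : ℝ} (hδ : 0 < δ) (h : 2 * δ < |x - g|) : cutoff g δ x = 0 := by
  have : 2 ≤ |x - g| / δ := by rw [le_div_iff₀ hδ]; exact h.le
  rw [cutoff]
  exact max_eq_left ((min_le_right _ _).trans (by linarith))

/-- The complement of the annulus `δ ≤ |x - g| ≤ 2 δ`. -/
def gapSet (g δ : ℝ) : Set ℝ := {x | |x - g| < δ} ∪ {x | 2 * δ < |x - g|}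

theorem isOpen_gapSet (g δ : ℝ) : IsOpen (gapSet g δ) :=
  (isOpen_lt (by fun_prop) (by fun_prop)).union (isOpen_lt (by fun_prop) (by fun_prop))

variable {H : Type*} [NormedAddCommGroup H] [InnerProductSpace ℂ H] [CompleteSpace H]

/-- The cutoff takes only the values `0` and `1` on a spectrum that avoids the annulus, so neither a
Borel calculus nor a contour integral is needed to obtain a projection. -/
theorem isIdempotentElem_cfc_cutoff {a : H →L[ℂ] H} {g δ : ℝ} (hδ : 0 < δ)
    (hs : spectrum ℝ a ⊆ gapSet g δ) :
    cfc (cutoff g δ) a * cfc (cutoff g δ) a = cfc (cutoff g δ) a := by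
  have hc : ContinuousOn (cutoff g δ) (spectrum ℝ a) := (continuous_cutoff g δ).continuousOn
  rw [← cfc_mul _ _ a hc hc]
  refine cfc_congr fun x hx => ?_
  rcases hs hx with h | h
  · simp [cutoff_eq_one hδ h]
  · simp [cutoff_eq_zero hδ h]

theorem commute_cfc_cutoff {a : H →L[ℂ] H} (ha : IsSelfAdjoint a) (g δ : ℝ) :
    Commute (cfc (cutoff g δ) a) a := by
  have h := cfc_commute_cfc (cutoff g δ) (id : ℝ → ℝ) a
  rwa [cfc_id ℝ a] at h

/-- A reduced resolvent: the part of the spectrum outside the window has distance more than `δ` from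
`μ`, so `(1 - cutoff) / (x - μ)` makes sense there. -/
theorem exists_inverse_off_cutoff {a : H →L[ℂ] H} (ha : IsSelfAdjoint a) {g δ μ : ℝ} (hδ : 0 < δ)
    (hs : spectrum ℝ a ⊆ gapSet g δ) (hμ : |μ - g| < δ) :
    ∃ N : H →L[ℂ] H, N * (a - (μ : ℂ) • 1) = 1 - cfc (cutoff g δ) a ∧
      (a - (μ : ℂ) • 1) * N = 1 - cfc (cutoff g δ) a := by
  -- The `max` only serves to make `k` continuous on the whole line. On the spectrum either the
  -- numerator vanishes or the maximum is `(x - μ) ^ 2`.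
  let k : ℝ → ℝ := fun x => (1 - cutoff g δ x) * (x - μ) / max ((x - μ) ^ 2) (δ ^ 2)
  have hpos : ∀ x, 0 < max ((x - μ) ^ 2) (δ ^ 2) := fun x => lt_max_of_lt_right (by positivity)
  have hkc : Continuous k :=
    ((continuous_const.sub (continuous_cutoff g δ)).mul (by fun_prop)).div (by fun_prop)
      fun x => (hpos x).ne'
  have hlin : cfc (fun x : ℝ => x - μ) a = a - (μ : ℂ) • 1 := by
    rw [cfc_sub (fun x : ℝ => x) (fun _ => μ) a, cfc_id' ℝ a, cfc_const μ a,
      Algebra.algebraMap_eq_smul_one]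
    rfl
  have hone : cfc (fun x : ℝ => 1 - cutoff g δ x) a = 1 - cfc (cutoff g δ) a := by
    have hc := (continuous_cutoff g δ).continuousOn (s := spectrum ℝ a)
    rw [cfc_sub (fun _ : ℝ => (1 : ℝ)) (cutoff g δ) a, cfc_const_one ℝ a]
  have hmul : cfc k a * (a - (μ : ℂ) • 1) = 1 - cfc (cutoff g δ) a := by
    rw [← hlin, ← hone, ← cfc_mul k _ a hkc.continuousOn (by fun_prop)]
    refine cfc_congr fun x hx => ?_
    rcases hs hx with h | h
    · simp [k, cutoff_eq_one hδ h]
    · have h1 : δ < |x - μ| := by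
        have h0 : 2 * δ < |x - g| := h
        have h2 := abs_sub_le x μ g
        linarith
      have h2 : δ ^ 2 ≤ (x - μ) ^ 2 := by
        rw [← sq_abs (x - μ)]; gcongr
      have h3 : x - μ ≠ 0 := abs_pos.mp (hδ.trans h1)
      simp only [k, max_eq_left h2, cutoff_eq_zero hδ h]
      field_simp
  refine ⟨cfc k a, hmul, ?_⟩
  rw [← hmul, ← hlin]
  exact (cfc_commute_cfc _ _ a).eq

end SpectralCutoff

/-! ### Eigenbases and counting of multiplicities -/

section Eigenbases

variable {H : Type*} [NormedAddCommGroup H] [InnerProductSpace ℂ H]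

theorem exists_orthonormal_eigenvectors [CompleteSpace H] {a P : H →L[ℂ] H} (ha : IsSelfAdjoint a)
    (hcomm : Commute P a) [FiniteDimensional ℂ P.range]
    {m : ℕ} (hm : Module.finrank ℂ P.range = m) :
    ∃ (x : Fin m → H) (μ : Fin m → ℝ), Orthonormal ℂ x ∧ (∀ k, a (x k) = (μ k : ℂ) • x k) ∧
      Submodule.span ℂ (Set.range x) = P.range := by
  have hinv : ∀ v ∈ P.range, (a : H →ₗ[ℂ] H) v ∈ P.range := by
    rintro _ ⟨w, rfl⟩
    exact ⟨a w, congrArg (fun f : H →L[ℂ] H => f w) hcomm.eq⟩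
  have hsym : ((a : H →ₗ[ℂ] H).restrict hinv).IsSymmetric :=
    (ContinuousLinearMap.isSelfAdjoint_iff_isSymmetric.mp ha).restrict_invariant hinv
  refine ⟨fun k => hsym.eigenvectorBasis hm k, hsym.eigenvalues hm,
    (hsym.eigenvectorBasis hm).orthonormal.comp_linearIsometry P.range.subtypeₗᵢ, fun k => ?_, ?_⟩
  · exact congrArg Subtype.val (hsym.apply_eigenvectorBasis hm k)
  · have h := congrArg (Submodule.map P.range.subtype)
      (hsym.eigenvectorBasis hm).toBasis.span_eq
    rw [Submodule.map_span, Submodule.map_top, Submodule.range_subtype, ← Set.range_comp] at h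
    refine Eq.trans (congrArg _ (congrArg Set.range (funext fun k => ?_))) h
    simp

theorem finrank_eigenspace_inf_span {a : Module.End ℂ H} {m : ℕ} {x : Fin m → H} {μ : Fin m → ℝ}
    (hx : LinearIndependent ℂ x) (hax : ∀ k, a (x k) = (μ k : ℂ) • x k) (z : ℝ) :
    Module.finrank ℂ ↥(a.eigenspace (z : ℂ) ⊓ Submodule.span ℂ (Set.range x)) =
      Nat.card {k // μ k = z} := by
  have heq : a.eigenspace (z : ℂ) ⊓ Submodule.span ℂ (Set.range x) =
      Submodule.span ℂ (Set.range (x ∘ ((↑) : {k // μ k = z} → Fin m))) := by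
    apply le_antisymm
    · rintro y ⟨hy, hyx⟩
      obtain ⟨c, rfl⟩ := (Submodule.mem_span_range_iff_exists_fun ℂ).mp hyx
      have h1 : ∑ k, (c k * ((μ k : ℂ) - z)) • x k = 0 := by
        have h2 := Module.End.mem_eigenspace_iff.mp hy
        rw [map_sum, Finset.smul_sum, ← sub_eq_zero, ← Finset.sum_sub_distrib] at h2
        rw [← h2]
        refine Finset.sum_congr rfl fun k _ => ?_
        rw [map_smul, hax]
        module
      have h3 := Fintype.linearIndependent_iff.mp hx _ h1
      refine Submodule.sum_mem _ fun k _ => ?_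
      by_cases hk : μ k = z
      · exact Submodule.smul_mem _ _ (Submodule.subset_span ⟨⟨k, hk⟩, rfl⟩)
      · have h4 : (μ k : ℂ) - z ≠ 0 := by
          rw [sub_ne_zero]; exact_mod_cast hk
        rw [(mul_eq_zero.mp (h3 k)).resolve_right h4, zero_smul]
        exact Submodule.zero_mem _
    · rw [Submodule.span_le]
      rintro _ ⟨k, rfl⟩
      refine ⟨?_, Submodule.subset_span ⟨k, rfl⟩⟩
      rw [SetLike.mem_coe, Module.End.mem_eigenspace_iff, Function.comp_apply, hax, k.2]
  rw [heq, finrank_span_eq_card (hx.comp _ Subtype.val_injective), Nat.card_eq_fintype_card]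

/-- Equal fibre sizes make `p` and `q` rearrangements of each other, and a sorted list is determined
by its multiset of entries. -/
theorem eq_of_monotone_of_card_fiber_eq {m : ℕ} {p q : Fin m → ℝ} (hp : Monotone p)
    (hq : Monotone q) (h : ∀ z, Nat.card {k // p k = z} = Nat.card {k // q k = z}) : p = q := by
  let σ : Equiv.Perm (Fin m) := (Equiv.sigmaFiberEquiv p).symm.trans
    ((Equiv.sigmaCongrRight fun z => Classical.choice (Finite.card_eq.mp (h z))).trans
      (Equiv.sigmaFiberEquiv q))
  have hσ : q ∘ σ = p := by
    funext k
    exact (Classical.choice (Finite.card_eq.mp (h (p k))) ⟨k, rfl⟩).2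
  have hperm : (List.ofFn p).Perm (List.ofFn q) := by
    rw [← hσ]
    exact σ.ofFn_comp_perm q
  exact List.ofFn_injective
    (hperm.eq_of_pairwise' hp.sortedLE_ofFn.pairwise hq.sortedLE_ofFn.pairwise)

/-- `Q` is injective on `ran P`: if `P x = x` and `Q x = 0`, then `‖x‖ = ‖(P - Q) x‖`, which forces
`x = 0`. Used in both directions, it keeps the rank of the spectral projections constant. -/
theorem finrank_range_le_of_norm_sub_lt_one {P Q : H →L[ℂ] H} (hP : P * P = P) (h : ‖P - Q‖ < 1)
    [FiniteDimensional ℂ Q.range] :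
    FiniteDimensional ℂ P.range ∧ Module.finrank ℂ P.range ≤ Module.finrank ℂ Q.range := by
  let f : P.range →ₗ[ℂ] Q.range := (Q : H →ₗ[ℂ] H).rangeRestrict ∘ₗ P.range.subtype
  have hf : Function.Injective f := by
    rw [← LinearMap.ker_eq_bot, LinearMap.ker_eq_bot']
    rintro ⟨_, w, rfl⟩ hw
    have hQ : Q (P w) = 0 := congrArg Subtype.val hw
    have hPP : P (P w) = P w := congrArg (fun f : H →L[ℂ] H => f w) hP
    have h1 : P w = (P - Q) (P w) := by rw [sub_apply, hQ, hPP, sub_zero]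
    have h2 : ‖P w‖ ≤ ‖P - Q‖ * ‖P w‖ := by
      conv_lhs => rw [h1]
      exact (P - Q).le_opNorm _
    have h3 : ‖P w‖ = 0 := by
      by_contra hne
      have := (norm_nonneg (P w)).lt_of_ne' hne
      nlinarith
    exact Subtype.ext (norm_eq_zero.mp h3)
  exact ⟨FiniteDimensional.of_injective f hf, LinearMap.finrank_le_finrank_of_injective hf⟩

variable [CompleteSpace H]

/-- An orthonormal basis of eigenvectors for the part of the spectrum of `a` that lies within `δ`
of `g`, ordered so that the quotients `(μ k - g) / h` increase. -/
structure IsLocalEigenbasis (a : H →L[ℂ] H) (g δ h : ℝ) {m : ℕ} (x : Fin m → H)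
    (μ : Fin m → ℝ) : Prop where
  orthonormal : Orthonormal ℂ x
  apply_eq : ∀ k, a (x k) = (μ k : ℂ) • x k
  cutoff_apply : ∀ k, cfc (cutoff g δ) a (x k) = x k
  monotone : Monotone fun k => (μ k - g) / h
  finrank_eq : ∀ z : ℝ, |z - g| < δ →
    Module.finrank ℂ (Module.End.eigenspace (a : H →ₗ[ℂ] H) (z : ℂ)) = Nat.card {k // μ k = z}
  exists_eq : ∀ z : ℝ, |z - g| < δ → z ∈ spectrum ℝ a → ∃ k, μ k = z

theorem exists_isLocalEigenbasis {a : H →L[ℂ] H} (ha : IsSelfAdjoint a) {g δ : ℝ}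
    (hδ : 0 < δ) (hs : spectrum ℝ a ⊆ gapSet g δ)
    [FiniteDimensional ℂ (cfc (cutoff g δ) a).range] {m : ℕ}
    (hm : Module.finrank ℂ (cfc (cutoff g δ) a).range = m) (h : ℝ) :
    ∃ (x : Fin m → H) (μ : Fin m → ℝ), IsLocalEigenbasis a g δ h x μ := by
  have hP := isIdempotentElem_cfc_cutoff hδ hs
  have hc := commute_cfc_cutoff ha g δ
  obtain ⟨x, μ, hx, hax, hspan⟩ := exists_orthonormal_eigenvectors ha hc hm
  set P := cfc (cutoff g δ) a
  let σ := Tuple.sort fun k => (μ k - g) / h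
  have hPx : ∀ k, P (x k) = x k := by
    intro k
    have h1 : x k ∈ P.range := hspan ▸ Submodule.subset_span ⟨k, rfl⟩
    obtain ⟨w, hw⟩ := h1
    have hw' : P w = x k := hw
    rw [← hw']
    exact congrArg (fun f : H →L[ℂ] H => f w) hP
  have hxσ : Orthonormal ℂ (x ∘ σ) := hx.comp _ σ.injective
  have hspanσ : Submodule.span ℂ (Set.range (x ∘ σ)) = P.range := by
    rw [σ.surjective.range_comp, hspan]
  -- Applying `N (a - z) = 1 - P` to an eigenvector `y` gives `0 = y - P y`.
  have hle : ∀ z : ℝ, |z - g| < δ →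
      Module.End.eigenspace (a : H →ₗ[ℂ] H) (z : ℂ) ≤ P.range := by
    intro z hz y hy
    obtain ⟨N, hN1, -⟩ := exists_inverse_off_cutoff ha hδ hs hz
    have hy' : a y = (z : ℂ) • y := Module.End.mem_eigenspace_iff.mp hy
    have h1 := congrArg (fun f : H →L[ℂ] H => f y) hN1
    simp only [mul_apply_eq_comp, sub_apply, smul_apply,
      one_apply_eq_self, hy', sub_self, map_zero] at h1
    exact ⟨y, (sub_eq_zero.mp h1.symm).symm⟩
  refine ⟨x ∘ σ, μ ∘ σ, hxσ, fun k => hax _, fun k => hPx _,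
    Tuple.monotone_sort fun k => (μ k - g) / h, fun z hz => ?_, fun z hz hzs => ?_⟩
  · rw [← finrank_eigenspace_inf_span (a := (a : H →ₗ[ℂ] H)) hxσ.linearIndependent
      (μ := μ ∘ σ) (fun k => hax _) z, hspanσ, inf_eq_left.mpr (hle z hz)]
  -- If no `μ k` equals `z`, then `a - z` is invertible: its kernel lies in `ran P`, where `a` is
  -- diagonal with entries different from `z`, and in `y = (1 - P) y + P y` the first part is
  -- reached through `N`, the second by dividing the coordinates by `μ k - z`.
  · by_contra! hne
    obtain ⟨N, -, hN2⟩ := exists_inverse_off_cutoff ha hδ hs hz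
    apply hzs
    have hne' : ∀ k, ((μ k : ℂ) - z) ≠ 0 := fun k => by
      rw [sub_ne_zero]
      have := hne (σ.symm k)
      simp only [Function.comp_apply, Equiv.apply_symm_apply] at this
      exact_mod_cast this
    have hinj : ∀ y, (a - (z : ℂ) • 1 : H →L[ℂ] H) y = 0 → y = 0 := by
      intro y hy
      have hy' : y ∈ Module.End.eigenspace (a : H →ₗ[ℂ] H) (z : ℂ) := by
        rw [Module.End.mem_eigenspace_iff]
        simpa [sub_eq_zero] using hy
      have h1 := hle z hz hy'
      rw [← hspan, Submodule.mem_span_range_iff_exists_fun] at h1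
      obtain ⟨c, rfl⟩ := h1
      have h2 : ∑ k, (c k * ((μ k : ℂ) - z)) • x k = 0 := by
        rw [← hy, map_sum]
        refine Finset.sum_congr rfl fun k _ => ?_
        simp only [map_smul, sub_apply, smul_apply, one_apply_eq_self, hax]
        module
      have h3 := Fintype.linearIndependent_iff.mp hx.linearIndependent _ h2
      refine Finset.sum_eq_zero fun k _ => ?_
      rw [(mul_eq_zero.mp (h3 k)).resolve_right (hne' k), zero_smul]
    have hsurj : ∀ y, ∃ w, (a - (z : ℂ) • 1 : H →L[ℂ] H) w = y := by
      intro y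
      have h1 := congrArg (fun f : H →L[ℂ] H => f y) hN2
      simp only [mul_apply_eq_comp, sub_apply,
        one_apply_eq_self] at h1
      have h2 : P y ∈ P.range := ⟨y, rfl⟩
      rw [← hspan, Submodule.mem_span_range_iff_exists_fun] at h2
      obtain ⟨c, hc⟩ := h2
      refine ⟨N y + ∑ k, (c k / ((μ k : ℂ) - z)) • x k, ?_⟩
      have h3 : (a - (z : ℂ) • 1 : H →L[ℂ] H) (∑ k, (c k / ((μ k : ℂ) - z)) • x k) = P y := by
        rw [map_sum, ← hc]
        refine Finset.sum_congr rfl fun k _ => ?_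
        simp only [map_smul, sub_apply, smul_apply, one_apply_eq_self, hax]
        rw [← sub_smul, smul_smul, div_mul_cancel₀ _ (hne' k)]
      rw [map_add, h3, sub_apply]
      rw [h1]; abel
    have hu : IsUnit (a - (z : ℂ) • 1 : H →L[ℂ] H) := by
      rw [ContinuousLinearMap.isUnit_iff_bijective]
      exact ⟨(injective_iff_map_eq_zero _).mpr hinj, hsurj⟩
    have h4 : algebraMap ℝ (H →L[ℂ] H) z - a = -(a - (z : ℂ) • 1) := by
      rw [neg_sub, Algebra.algebraMap_eq_smul_one]; rfl
    show IsUnit (algebraMap ℝ (H →L[ℂ] H) z - a)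
    rw [h4]
    exact hu.neg

end Eigenbases

/-! ### Differentiability of eigenvalue branches of bounded self-adjoint families -/

section Branches

variable {H : Type*} [NormedAddCommGroup H] [InnerProductSpace ℂ H]

/-- Monotone limits of the difference quotients of eigenvalues are the eigenvalues of the
compressed derivative. -/
theorem tendsto_quotient_of_sorted_eigenbases {ι : Type*} {l : Filter ι} {a a' P₀ : H →L[ℂ] H}
    {G P : ι → H →L[ℂ] H} {τ : ι → ℝ} {g : ℝ} {m : ℕ}
    {x : ι → Fin m → H} {μ : ι → Fin m → ℝ} {u : Fin m → H} {d : Fin m → ℝ}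
    [FiniteDimensional ℂ P₀.range] (hP₀ : P₀ * P₀ = P₀)
    (hP₀a : P₀ * a = (g : ℂ) • P₀) (hP : Tendsto P l (𝓝 P₀))
    (hG : Tendsto (fun i => ((τ i : ℂ)⁻¹) • (G i - a)) l (𝓝 a'))
    (hx : ∀ᶠ i in l, Orthonormal ℂ (x i)) (hGx : ∀ᶠ i in l, ∀ k, G i (x i k) = (μ i k : ℂ) • x i k)
    (hPx : ∀ᶠ i in l, ∀ k, P i (x i k) = x i k)
    (hmono : ∀ᶠ i in l, Monotone fun k => (μ i k - g) / τ i)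
    (hu : Orthonormal ℂ u) (hspan : Submodule.span ℂ (Set.range u) = P₀.range)
    (hdu : ∀ k, (P₀ * a' * P₀) (u k) = (d k : ℂ) • u k) (hd : Monotone d) (k : Fin m) :
    Tendsto (fun i => (μ i k - g) / τ i) l (𝓝 (d k)) := by
  -- Along an ultrafilter bounded families in a finite-dimensional space converge, which replaces
  -- the passage to subsequences. The limit found at the end is the same `d k` for every
  -- ultrafilter.
  rw [tendsto_iff_ultrafilter]
  intro 𝒰 h𝒰
  replace hP := hP.mono_left h𝒰
  replace hG := hG.mono_left h𝒰
  replace hx := h𝒰 hx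
  replace hGx := h𝒰 hGx
  replace hPx := h𝒰 hPx
  replace hmono := h𝒰 hmono
  set ν : ι → Fin m → ℝ := fun i k => (μ i k - g) / τ i with hν
  -- the projected eigenvectors
  have hy : ∀ k, ∃ z ∈ P₀.range, Tendsto (fun i => P₀ (x i k)) 𝒰 (𝓝 z) := by
    intro k
    let y : ι → P₀.range := fun i => (P₀ : H →ₗ[ℂ] H).rangeRestrict (x i k)
    have : ProperSpace P₀.range := FiniteDimensional.proper ℂ _
    have hb : Metric.closedBall (0 : P₀.range) ‖P₀‖ ∈ 𝒰.map y := by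
      show ∀ᶠ i in 𝒰, y i ∈ Metric.closedBall (0 : P₀.range) ‖P₀‖
      filter_upwards [hx] with i hi
      rw [mem_closedBall_zero_iff]
      calc ‖P₀ (x i k)‖ ≤ ‖P₀‖ * ‖x i k‖ := P₀.le_opNorm _
        _ = ‖P₀‖ := by rw [hi.1 k, mul_one]
    obtain ⟨z, -, hz⟩ := (isCompact_closedBall (0 : P₀.range) ‖P₀‖).ultrafilter_le_nhds' _ hb
    exact ⟨z, z.2, (continuous_subtype_val.tendsto z).comp hz⟩
  choose z hzP hz using hy
  -- Because `P i` fixes `x i k`, the difference `x i k - P₀ (x i k)` is `(P i - P₀) (x i k)`, which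
  -- tends to `0`.
  have hxz : ∀ k, Tendsto (fun i => x i k) 𝒰 (𝓝 (z k)) := by
    intro k
    have h1 : Tendsto (fun i => (P i - P₀) (x i k)) 𝒰 (𝓝 0) := by
      rw [tendsto_zero_iff_norm_tendsto_zero]
      have h2 : Tendsto (fun i => ‖P i - P₀‖) 𝒰 (𝓝 0) := by
        simpa using (hP.sub_const P₀).norm
      refine squeeze_zero' (.of_forall fun _ => norm_nonneg _) ?_ h2
      filter_upwards [hx] with i hi
      simpa [hi.1 k] using (P i - P₀).le_opNorm (x i k)
    have h3 := h1.add (hz k)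
    rw [zero_add] at h3
    refine h3.congr' ?_
    filter_upwards [hPx] with i hi
    rw [sub_apply, hi k, sub_add_cancel]
  have hzo : Orthonormal ℂ z := by
    rw [orthonormal_iff_ite]
    intro p q
    refine tendsto_nhds_unique ((hxz p).inner (hxz q)) (tendsto_const_nhds.congr' ?_)
    filter_upwards [hx] with i hi
    exact (orthonormal_iff_ite.mp hi p q).symm
  have hPz : ∀ k, P₀ (z k) = z k := by
    intro k
    obtain ⟨w, hw⟩ := hzP k
    rw [← hw]
    exact congrArg (fun f : H →L[ℂ] H => f w) hP₀
  -- Applying `P₀` turns `a` into the scalar `g`, so the difference quotient of the operators acts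
  -- on `x i k` as the difference quotient of the eigenvalues.
  have hid : ∀ k, ∀ᶠ i in 𝒰,
      P₀ (((τ i : ℂ)⁻¹ • (G i - a)) (x i k)) = (ν i k : ℂ) • P₀ (x i k) := by
    intro k
    filter_upwards [hGx] with i hi
    have h1 : P₀ (a (x i k)) = (g : ℂ) • P₀ (x i k) :=
      congrArg (fun f : H →L[ℂ] H => f (x i k)) hP₀a
    rw [smul_apply, sub_apply, hi k, map_smul, map_sub, map_smul, h1, ← sub_smul, smul_smul]
    congr 1
    simp only [hν]
    push_cast
    ring
  have hlim : ∀ k, Tendsto (fun i => (ν i k : ℂ) • P₀ (x i k)) 𝒰 (𝓝 (P₀ (a' (z k)))) := by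
    intro k
    have h1 : Tendsto (fun i => P₀ (((τ i : ℂ)⁻¹ • (G i - a)) (x i k))) 𝒰
        (𝓝 (P₀ (a' (z k)))) :=
      (P₀.continuous.tendsto _).comp
        ((isBoundedBilinearMap_apply.continuous.tendsto (a', z k)).comp (hG.prodMk_nhds (hxz k)))
    exact h1.congr' (hid k)
  -- taking the scalar product with the projected eigenvector
  have hn : ∀ k, ∃ n : ℝ, Tendsto (fun i => ν i k) 𝒰 (𝓝 n) := by
    intro k
    have h1 := (hz k).inner (𝕜 := ℂ) (hlim k)
    have h2 := (hz k).inner (𝕜 := ℂ) (hz k)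
    have h3 : inner ℂ (z k) (z k) = (1 : ℂ) := by
      rw [inner_self_eq_norm_sq_to_K, hzo.1 k]; norm_num
    rw [h3] at h2
    -- The ratio of the two scalar products is `ν i k` itself once the denominator is nonzero.
    -- Boundedness of the quotients is thus a conclusion and not an assumption.
    have h4 := (Complex.continuous_re.tendsto _).comp (h1.div h2 one_ne_zero)
    refine ⟨_, h4.congr' ?_⟩
    filter_upwards [h2.eventually_ne one_ne_zero] with i hi
    simp only [Function.comp_apply, Pi.div_apply, inner_smul_right]
    rw [mul_div_cancel_right₀ _ hi, Complex.ofReal_re]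
  choose n hn using hn
  have hzn : ∀ k, (P₀ * a' * P₀) (z k) = (n k : ℂ) • z k := by
    intro k
    have h1 : Tendsto (fun i => (ν i k : ℂ) • P₀ (x i k)) 𝒰 (𝓝 ((n k : ℂ) • z k)) :=
      ((Complex.continuous_ofReal.tendsto _).comp (hn k)).smul (hz k)
    have h2 := tendsto_nhds_unique (hlim k) h1
    rw [mul_apply_eq_comp, mul_apply_eq_comp, hPz, h2]
  have hnm : Monotone n := by
    intro p q hpq
    refine le_of_tendsto_of_tendsto (hn p) (hn q) ?_
    filter_upwards [hmono] with i hi using hi hpq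
  have hzspan : Submodule.span ℂ (Set.range z) = Submodule.span ℂ (Set.range u) := by
    rw [hspan]
    refine Submodule.eq_of_le_of_finrank_eq ?_ ?_
    · rw [Submodule.span_le]
      rintro _ ⟨k, rfl⟩
      exact hzP k
    · rw [← hspan, finrank_span_eq_card hzo.linearIndependent,
        finrank_span_eq_card hu.linearIndependent]
  have hnd : n = d := by
    -- Both fibre sizes are the multiplicity of `w` for the compression `P₀ a' P₀` on `ran P₀`.
    refine eq_of_monotone_of_card_fiber_eq hnm hd fun w => ?_
    rw [← finrank_eigenspace_inf_span (a := ((P₀ * a' * P₀ : H →L[ℂ] H) : H →ₗ[ℂ] H))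
      hzo.linearIndependent hzn w, hzspan,
      finrank_eigenspace_inf_span (a := ((P₀ * a' * P₀ : H →L[ℂ] H) : H →ₗ[ℂ] H))
      hu.linearIndependent hdu w]
  rw [← hnd]
  exact hn k

variable [CompleteSpace H]

theorem tendsto_cfc_cutoff {ι : Type*} {l : Filter ι} {G : ι → H →L[ℂ] H} {a : H →L[ℂ] H}
    (hG : Tendsto G l (𝓝 a)) (hsa : ∀ᶠ i in l, IsSelfAdjoint (G i)) (ha : IsSelfAdjoint a)
    (g δ : ℝ) : Tendsto (fun i => cfc (cutoff g δ) (G i)) l (𝓝 (cfc (cutoff g δ) a)) := by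
  have hsub : ∀ b : H →L[ℂ] H, ‖b‖ < ‖a‖ + 1 →
      spectrum ℝ b ⊆ Metric.closedBall (0 : ℝ) (‖a‖ + 1) := fun b hb =>
    (spectrum.subset_closedBall_norm_mul b).trans <| Metric.closedBall_subset_closedBall <| by
      have h1 : ‖(1 : H →L[ℂ] H)‖ ≤ 1 := ContinuousLinearMap.norm_id_le
      nlinarith [norm_nonneg b]
  refine hG.cfc (isCompact_closedBall (0 : ℝ) (‖a‖ + 1)) _ ?_ hsa (hsub a (by linarith)) ha
    (continuous_cutoff g δ).continuousOn
  filter_upwards [hG.norm.eventually_lt_const (lt_add_one ‖a‖)] with i hi using hsub _ hi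

/-- The cutoff vanishes on the spectrum except possibly at `g`, so `x * cutoff x = g * cutoff x`
there. -/
theorem range_cfc_cutoff_of_isolated {a : H →L[ℂ] H} (ha : IsSelfAdjoint a) {g δ : ℝ} (hδ : 0 < δ)
    (hiso : ∀ z ∈ spectrum ℝ a, |z - g| < 3 * δ → z = g) :
    spectrum ℝ a ⊆ gapSet g δ ∧ a * cfc (cutoff g δ) a = (g : ℂ) • cfc (cutoff g δ) a ∧
      (cfc (cutoff g δ) a).range = Module.End.eigenspace (a : H →ₗ[ℂ] H) (g : ℂ) := by
  have hs : spectrum ℝ a ⊆ gapSet g δ := by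
    intro z hz
    by_cases h : |z - g| < 3 * δ
    · left; simp [hiso z hz h, hδ]
    · right
      show 2 * δ < |z - g|
      linarith
  have hmul : a * cfc (cutoff g δ) a = (g : ℂ) • cfc (cutoff g δ) a := by
    have h1 : cfc (fun x : ℝ => x * cutoff g δ x) a = a * cfc (cutoff g δ) a := by
      rw [cfc_mul (fun x : ℝ => x) _ a (by fun_prop) (continuous_cutoff g δ).continuousOn,
        cfc_id' ℝ a]
    have h2 : cfc (fun x : ℝ => g • cutoff g δ x) a = g • cfc (cutoff g δ) a :=
      cfc_smul g _ a (continuous_cutoff g δ).continuousOn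
    rw [← h1]
    refine Eq.trans (cfc_congr fun x hx => ?_) h2
    rcases hs hx with h | h
    · rw [hiso x hx (lt_trans h (by linarith)), smul_eq_mul]
    · simp [cutoff_eq_zero hδ h]
  refine ⟨hs, hmul, le_antisymm ?_ fun y hy => ?_⟩
  · rintro _ ⟨w, rfl⟩
    rw [Module.End.mem_eigenspace_iff]
    exact congrArg (fun f : H →L[ℂ] H => f w) hmul
  · obtain ⟨N, hN, -⟩ := exists_inverse_off_cutoff (μ := g) ha hδ hs (by simpa using hδ)
    have hy' : a y = (g : ℂ) • y := Module.End.mem_eigenspace_iff.mp hy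
    have h1 := congrArg (fun f : H →L[ℂ] H => f y) hN
    simp only [mul_apply_eq_comp, sub_apply, smul_apply,
      one_apply_eq_self, hy', sub_self, map_zero] at h1
    exact ⟨y, (sub_eq_zero.mp h1.symm).symm⟩

/-- Splitting of an isolated eigenvalue of finite multiplicity of a bounded self-adjoint operator:
the eigenvalues are differentiable, and the derivatives are the eigenvalues of the compression of
the derivative to the eigenspace. -/
theorem exists_differentiable_eigenvalues {G : ℝ → H →L[ℂ] H} {G' : H →L[ℂ] H} {s : Set ℝ}
    {t₀ : ℝ} (ht₀ : t₀ ∈ s) (hsa : ∀ᶠ t in 𝓝[s] t₀, IsSelfAdjoint (G t)) (hsa' : IsSelfAdjoint G')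
    (hd : HasDerivWithinAt G G' s t₀) {g ε : ℝ} (hε : 0 < ε)
    (hiso : ∀ z ∈ spectrum ℝ (G t₀), |z - g| < ε → z = g) {m : ℕ} (hm1 : 1 ≤ m)
    (hm : Module.finrank ℂ (Module.End.eigenspace (G t₀ : H →ₗ[ℂ] H) (g : ℂ)) = m) :
    ∃ (u : Fin m → H) (d : Fin m → ℝ) (γ : Fin m → ℝ → ℝ), Orthonormal ℂ u ∧
      (∀ k, G t₀ (u k) = (g : ℂ) • u k) ∧ (∀ k, (d k : ℂ) = inner ℂ (u k) (G' (u k))) ∧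
      (∀ k, γ k t₀ = g) ∧ (∀ k, HasDerivWithinAt (γ k) (d k) s t₀) ∧
      ∃ δ > 0, ∀ᶠ t in 𝓝[s] t₀, ∀ z : ℝ, |z - g| < δ →
        Module.finrank ℂ (Module.End.eigenspace (G t : H →ₗ[ℂ] H) (z : ℂ)) =
          Nat.card {k // γ k t = z} ∧
        (z ∈ spectrum ℝ (G t) → ∃ k, γ k t = z) := by
  have ha : IsSelfAdjoint (G t₀) := hsa.self_of_nhdsWithin ht₀
  set a := G t₀ with ha_def
  -- The cutoff lives on `|x - g| ≤ 2 δ`; a radius of `3 δ` leaves its transition annulus free of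
  -- spectrum.
  set δ := ε / 3 with hδ_def
  have hδ : 0 < δ := by positivity
  obtain ⟨hs, haP, hrange⟩ := range_cfc_cutoff_of_isolated ha hδ (g := g) (fun z hz h =>
    hiso z hz (by rw [hδ_def] at h; linarith))
  set P : ℝ → H →L[ℂ] H := fun t => cfc (cutoff g δ) (G t) with hP_def
  have hGc : Tendsto G (𝓝[s] t₀) (𝓝 a) := hd.continuousWithinAt
  have hPc : Tendsto P (𝓝[s] t₀) (𝓝 (P t₀)) := tendsto_cfc_cutoff hGc hsa ha g δ
  have hP₀ : P t₀ * P t₀ = P t₀ := isIdempotentElem_cfc_cutoff hδ hs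
  have hcomm : Commute (P t₀) a := commute_cfc_cutoff ha g δ
  have hPsa : IsSelfAdjoint (P t₀) := cfc_predicate _ _
  have hm0 : Module.finrank ℂ (P t₀).range = m := by rw [← hm, ← hrange]
  have hfd : FiniteDimensional ℂ (P t₀).range :=
    Module.finite_of_finrank_pos (by omega)
  -- Upper semicontinuity of the spectrum: the open set `gapSet` contains the spectrum at `t₀`,
  -- hence also the nearby ones.
  have hgap : ∀ᶠ t in 𝓝[s] t₀, spectrum ℝ (G t) ⊆ gapSet g δ :=
    hGc.eventually ((upperHemicontinuous_spectrum ℝ (H →L[ℂ] H)).forall_isOpen a _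
      (isOpen_gapSet g δ) hs)
  have hclose : ∀ᶠ t in 𝓝[s] t₀, ‖P t - P t₀‖ < 1 := by
    have h1 : Tendsto (fun t => ‖P t - P t₀‖) (𝓝[s] t₀) (𝓝 0) := by
      simpa using (hPc.sub_const (P t₀)).norm
    exact h1.eventually_lt_const one_pos
  have hex : ∀ᶠ t in 𝓝[s] t₀, ∃ p : (Fin m → H) × (Fin m → ℝ),
      IsLocalEigenbasis (G t) g δ (t - t₀) p.1 p.2 := by
    filter_upwards [hsa, hgap, hclose] with t h1 h2 h3
    obtain ⟨hf, hle⟩ := finrank_range_le_of_norm_sub_lt_one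
      (isIdempotentElem_cfc_cutoff hδ h2) h3
    obtain ⟨-, hge⟩ := finrank_range_le_of_norm_sub_lt_one (Q := P t) hP₀
      (by rwa [norm_sub_rev])
    obtain ⟨x, μ, h⟩ :=
      exists_isLocalEigenbasis h1 hδ h2 ((le_antisymm hle hge).trans hm0) (t - t₀)
    exact ⟨(x, μ), h⟩
  have : (𝓝[s] t₀).NeBot := mem_closure_iff_nhdsWithin_neBot.mp (subset_closure ht₀)
  -- The eigenbases are chosen separately for each `t`, without any regularity in `t`; the sorted
  -- quotients alone yield the derivative.
  obtain ⟨p, hp⟩ := hex.choice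
  have hp₀ : ∀ k, (p t₀).2 k = g := by
    intro k
    have h := hp.self_of_nhdsWithin ht₀
    have h1 : (p t₀).1 k ∈ Module.End.eigenspace (a : H →ₗ[ℂ] H) (g : ℂ) :=
      hrange ▸ ⟨(p t₀).1 k, h.cutoff_apply k⟩
    have h2 : a ((p t₀).1 k) = (g : ℂ) • (p t₀).1 k := Module.End.mem_eigenspace_iff.mp h1
    exact_mod_cast smul_left_injective ℂ (h.orthonormal.ne_zero k) ((h.apply_eq k).symm.trans h2)
  -- eigenvectors of the compressed derivative
  have hDsa : IsSelfAdjoint (P t₀ * G' * P t₀) := by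
    have := hsa'.conjugate (P t₀)
    rwa [hPsa.star_eq] at this
  have hDcomm : Commute (P t₀) (P t₀ * G' * P t₀) := by
    show P t₀ * (P t₀ * G' * P t₀) = P t₀ * G' * P t₀ * P t₀
    rw [mul_assoc (P t₀ * G'), hP₀, ← mul_assoc, ← mul_assoc, hP₀]
  obtain ⟨u₁, d₁, hu₁, hdu₁, hspan₁⟩ := exists_orthonormal_eigenvectors hDsa hDcomm hm0
  let σ := Tuple.sort d₁
  have hspan : Submodule.span ℂ (Set.range (u₁ ∘ σ)) = (P t₀).range := by
    rw [σ.surjective.range_comp, hspan₁]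
  have hmem : ∀ k, u₁ (σ k) ∈ (P t₀).range := fun k =>
    hspan ▸ Submodule.subset_span ⟨k, rfl⟩
  have hPu : ∀ k, P t₀ (u₁ (σ k)) = u₁ (σ k) := by
    intro k
    obtain ⟨w, hw⟩ := hmem k
    rw [← hw]
    exact congrArg (fun f : H →L[ℂ] H => f w) hP₀
  have hu : Orthonormal ℂ (u₁ ∘ σ) := hu₁.comp _ σ.injective
  refine ⟨u₁ ∘ σ, d₁ ∘ σ, fun k t => (p t).2 k, hu, fun k => ?_, fun k => ?_, hp₀,
    fun k => ?_, δ, hδ, hp.mono fun t ht z hz => ⟨ht.finrank_eq z hz, ht.exists_eq z hz⟩⟩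
  · exact Module.End.mem_eigenspace_iff.mp (hrange ▸ hmem k)
  · have h1 : inner ℂ (u₁ (σ k)) ((P t₀ * G' * P t₀) (u₁ (σ k))) =
        inner ℂ (u₁ (σ k)) (G' (u₁ (σ k))) := by
      rw [mul_apply_eq_comp, mul_apply_eq_comp, hPu]
      have h2 := (ContinuousLinearMap.isSelfAdjoint_iff_isSymmetric.mp hPsa)
        (u₁ (σ k)) (G' (u₁ (σ k)))
      rw [ContinuousLinearMap.coe_coe, hPu] at h2
      exact h2.symm
    rw [Function.comp_apply, Function.comp_apply, ← h1, hdu₁, inner_smul_right,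
      inner_self_eq_norm_sq_to_K, hu₁.1]
    simp
  · rw [hasDerivWithinAt_iff_tendsto_slope]
    have hle : 𝓝[s \ {t₀}] t₀ ≤ 𝓝[s] t₀ := nhdsWithin_mono _ Set.sdiff_subset
    have hG' : Tendsto (fun t => ((t - t₀ : ℝ) : ℂ)⁻¹ • (G t - a)) (𝓝[s \ {t₀}] t₀) (𝓝 G') := by
      refine (hasDerivWithinAt_iff_tendsto_slope.mp hd).congr fun t => ?_
      rw [slope_def_module, ← Complex.ofReal_inv]
      rfl
    have key := tendsto_quotient_of_sorted_eigenbases hP₀ (hcomm.eq.trans haP) (hPc.mono_left hle)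
      hG' (hle (hp.mono fun t h => h.orthonormal)) (hle (hp.mono fun t h => h.apply_eq))
      (hle (hp.mono fun t h => h.cutoff_apply)) (hle (hp.mono fun t h => h.monotone))
      hu hspan (d := d₁ ∘ σ) (fun k => hdu₁ _) (Tuple.monotone_sort d₁) k
    refine key.congr fun t => ?_
    rw [slope_def_field]
    simp only [hp₀]

end Branches

/-! ### Resolvents of unbounded operators through one base point -/

section Resolvents

variable {H : Type*} [NormedAddCommGroup H] [InnerProductSpace ℂ H]

theorem IsResolvent.unique {B : H →ₗ.[ℂ] H} {ζ : ℂ} {R R' : H →L[ℂ] H} (h : IsResolvent B ζ R)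
    (h' : IsResolvent B ζ R') : R = R' := by
  ext v
  obtain ⟨hd, hv⟩ := h'.1 v
  have := h.2 ⟨R' v, hd⟩
  rwa [hv] at this

theorem IsResolvent.mem {B : H →ₗ.[ℂ] H} {ζ : ℂ} {R : H →L[ℂ] H} (h : IsResolvent B ζ R) :
    ζ ∈ resolvSet B := ⟨R, h⟩

theorem IsResolvent.resolv_eq {B : H →ₗ.[ℂ] H} {ζ : ℂ} {R : H →L[ℂ] H} (h : IsResolvent B ζ R) :
    resolv B ζ = R := (resolv_spec h.mem).unique h

theorem notMem_spec {B : H →ₗ.[ℂ] H} {ζ : ℂ} : ζ ∉ spec B ↔ ζ ∈ resolvSet B := not_not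

theorem resolv_apply_mem {B : H →ₗ.[ℂ] H} {ζ : ℂ} (h : ζ ∈ resolvSet B) (v : H) :
    resolv B ζ v ∈ B.domain := ((resolv_spec h).1 v).1

theorem apply_resolv {B : H →ₗ.[ℂ] H} {ζ : ℂ} (h : ζ ∈ resolvSet B) (v : H) :
    B ⟨resolv B ζ v, resolv_apply_mem h v⟩ = v + ζ • resolv B ζ v :=
  sub_eq_iff_eq_add.mp ((resolv_spec h).1 v).2

/-- This rests on `B - ζ = (1 - (ζ - c) R) (B - c)` with `R = (B - c)⁻¹`. That `R` commutes with the
inverse `U` is needed for the other side of the inverse. -/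
theorem IsResolvent.of_isUnit {B : H →ₗ.[ℂ] H} {c ζ : ℂ} (hc : c ∈ resolvSet B)
    (hu : IsUnit (1 - (ζ - c) • resolv B c)) :
    IsResolvent B ζ (resolv B c * Ring.inverse (1 - (ζ - c) • resolv B c)) := by
  set R := resolv B c with hR
  set U := Ring.inverse (1 - (ζ - c) • R)
  have hU : (1 - (ζ - c) • R) * U = 1 := Ring.mul_inverse_cancel _ hu
  have hU' : U * (1 - (ζ - c) • R) = 1 := Ring.inverse_mul_cancel _ hu
  have hRc : Commute R (1 - (ζ - c) • R) :=
    (Commute.one_right R).sub_right ((Commute.refl R).smul_right _)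
  have hcomm : R * U = U * R := by
    calc R * U = U * (1 - (ζ - c) • R) * R * U := by rw [hU', one_mul]
      _ = U * R * ((1 - (ζ - c) • R) * U) := by rw [mul_assoc U, ← hRc.eq]; simp only [mul_assoc]
      _ = U * R := by rw [hU, mul_one]
  refine ⟨fun v => ⟨resolv_apply_mem hc _, ?_⟩, fun x => ?_⟩
  · have h1 := apply_resolv hc (U v)
    have h2 := congrArg (fun f : H →L[ℂ] H => f v) hU
    simp only [mul_apply_eq_comp, sub_apply, smul_apply, one_apply_eq_self] at h2
    refine Eq.trans ?_ h2
    refine (congrArg (· - ζ • (R * U) v) h1).trans ?_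
    simp only [mul_apply_eq_comp, ← hR]
    module
  · have h1 := (resolv_spec hc).2 x
    rw [← hR] at h1
    have h2 := congrArg (fun f : H →L[ℂ] H => f x) hU'
    simp only [mul_apply_eq_comp, sub_apply, smul_apply, one_apply_eq_self] at h2
    rw [hcomm, mul_apply_eq_comp]
    refine Eq.trans (congrArg U ?_) h2
    have h3 : B x - ζ • (x : H) = (B x - c • (x : H)) - (ζ - c) • (x : H) := by module
    rw [h3, map_sub, map_smul, h1]

/-- By the resolvent identity the inverse is `1 + (ζ - c) (B - ζ)⁻¹`. -/
theorem isUnit_of_mem_resolvSet {B : H →ₗ.[ℂ] H} {c ζ : ℂ} (hc : c ∈ resolvSet B)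
    (hζ : ζ ∈ resolvSet B) : IsUnit (1 - (ζ - c) • resolv B c) := by
  refine ⟨⟨1 - (ζ - c) • resolv B c, 1 + (ζ - c) • resolv B ζ, ?_, ?_⟩, rfl⟩
  · ext v
    have h1 := (resolv_spec hc).2 ⟨resolv B ζ v, resolv_apply_mem hζ v⟩
    rw [apply_resolv hζ] at h1
    have h2 : v + ζ • resolv B ζ v - c • resolv B ζ v = v + (ζ - c) • resolv B ζ v := by module
    rw [h2] at h1
    simp only [mul_apply_eq_comp, sub_apply, smul_apply, one_apply_eq_self, add_apply]
    rw [h1]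
    module
  · ext v
    have h1 := (resolv_spec hζ).2 ⟨resolv B c v, resolv_apply_mem hc v⟩
    rw [apply_resolv hc] at h1
    have h2 : v + c • resolv B c v - ζ • resolv B c v = v - (ζ - c) • resolv B c v := by module
    rw [h2] at h1
    simp only [mul_apply_eq_comp, sub_apply, smul_apply, one_apply_eq_self, add_apply]
    rw [h1]
    module

theorem mem_resolvSet_iff_isUnit {B : H →ₗ.[ℂ] H} {c ζ : ℂ} (hc : c ∈ resolvSet B) :
    ζ ∈ resolvSet B ↔ IsUnit (1 - (ζ - c) • resolv B c) :=
  ⟨isUnit_of_mem_resolvSet hc, fun h => (IsResolvent.of_isUnit hc h).mem⟩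

theorem resolv_eq_mul_inverse {B : H →ₗ.[ℂ] H} {c ζ : ℂ} (hc : c ∈ resolvSet B)
    (hζ : ζ ∈ resolvSet B) :
    resolv B ζ = resolv B c * Ring.inverse (1 - (ζ - c) • resolv B c) :=
  (IsResolvent.of_isUnit hc (isUnit_of_mem_resolvSet hc hζ)).resolv_eq

/-- Spectral mapping for `λ ↦ (λ - c)⁻¹`, from `z - R = z (1 - z⁻¹ R)`. The value `z = 0`
corresponds to no finite `λ`. -/
theorem mem_spec_iff_mem_spectrum {B : H →ₗ.[ℂ] H} {c z : ℝ} (hc : (c : ℂ) ∈ resolvSet B)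
    (hz : z ≠ 0) :
    ((c + z⁻¹ : ℝ) : ℂ) ∈ spec B ↔ z ∈ spectrum ℝ (resolv B (c : ℂ)) := by
  rw [spec, Set.mem_compl_iff, mem_resolvSet_iff_isUnit hc, spectrum.mem_iff, not_iff_not]
  have hz' : (z : ℂ) ≠ 0 := by exact_mod_cast hz
  have h1 : algebraMap ℝ (H →L[ℂ] H) z - resolv B c =
      (z : ℂ) • (1 - (((c + z⁻¹ : ℝ) : ℂ) - c) • resolv B c) := by
    rw [Algebra.algebraMap_eq_smul_one, smul_sub, smul_smul]
    push_cast
    rw [add_sub_cancel_left, mul_inv_cancel₀ hz', one_smul]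
    rfl
  rw [h1]
  exact (isUnit_smul_iff (Units.mk0 _ hz') _).symm

theorem eigSpace_eq_eigenspace {B : H →ₗ.[ℂ] H} {c ζ : ℂ} (hc : c ∈ resolvSet B) (hζ : ζ ≠ c) :
    eigSpace B ζ = Module.End.eigenspace (resolv B c : H →ₗ[ℂ] H) (ζ - c)⁻¹ := by
  have hne : ζ - c ≠ 0 := sub_ne_zero.mpr hζ
  ext x
  rw [Module.End.mem_eigenspace_iff]
  constructor
  · rintro ⟨hx, hBx⟩
    have h1 := (resolv_spec hc).2 ⟨x, hx⟩
    rw [hBx, ← sub_smul, map_smul] at h1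
    rw [eq_inv_smul_iff₀ hne]
    exact h1
  · intro h
    have h0 : resolv B c x = (ζ - c)⁻¹ • x := h
    have hx : (ζ - c)⁻¹ • x ∈ B.domain := h0 ▸ resolv_apply_mem hc x
    have hx' : x ∈ B.domain := by
      have := B.domain.smul_mem (ζ - c) hx
      rwa [smul_inv_smul₀ hne] at this
    refine ⟨hx', ?_⟩
    have h1 := apply_resolv hc x
    have h2 : (⟨resolv B c x, resolv_apply_mem hc x⟩ : B.domain) = (ζ - c)⁻¹ • ⟨x, hx'⟩ :=
      Subtype.ext h0
    rw [h2, LinearPMap.map_smul, h0, inv_smul_eq_iff₀ hne] at h1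
    rw [h1, smul_add, smul_comm c, smul_inv_smul₀ hne]
    module

theorem eigSpace_eq_bot {B : H →ₗ.[ℂ] H} {ζ : ℂ} (hζ : ζ ∈ resolvSet B) : eigSpace B ζ = ⊥ := by
  rw [eq_bot_iff]
  rintro x ⟨hx, hBx⟩
  have h1 := (resolv_spec hζ).2 ⟨x, hx⟩
  rw [hBx, sub_self, map_zero] at h1
  exact h1.symm

theorem addBdd_apply (B : H →ₗ.[ℂ] H) (V : H →L[ℂ] H) (x : B.domain) :
    addBdd B V x = V x + B x := rfl

theorem addBdd_mk {B : H →ₗ.[ℂ] H} {V : H →L[ℂ] H} {x : H} (hx : x ∈ (addBdd B V).domain) :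
    addBdd B V ⟨x, hx⟩ = V x + B ⟨x, hx⟩ := rfl

variable [CompleteSpace H]

/-- Invertibility is an open condition. It is stated jointly in the index and `ζ` so that compact
sets of `ζ` can be treated uniformly later. -/
theorem eventually_mem_resolvSet_prod {ι : Type*} {l : Filter ι} {B : ι → H →ₗ.[ℂ] H}
    {B₀ : H →ₗ.[ℂ] H} {c ζ₀ : ℂ} (hc : ∀ᶠ i in l, c ∈ resolvSet (B i)) (hc₀ : c ∈ resolvSet B₀)
    (hlim : Tendsto (fun i => resolv (B i) c) l (𝓝 (resolv B₀ c))) (hζ₀ : ζ₀ ∈ resolvSet B₀) :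
    ∀ᶠ p in l ×ˢ 𝓝 ζ₀, p.2 ∈ resolvSet (B p.1) := by
  have h1 : Tendsto (fun p : ι × ℂ => 1 - (p.2 - c) • resolv (B p.1) c) (l ×ˢ 𝓝 ζ₀)
      (𝓝 (1 - (ζ₀ - c) • resolv B₀ c)) :=
    ((tendsto_snd.sub_const c).smul (hlim.comp tendsto_fst)).const_sub 1
  filter_upwards [h1.eventually (Units.isOpen.mem_nhds (isUnit_of_mem_resolvSet hc₀ hζ₀)),
    hc.prod_inl _] with p hp hcp using (mem_resolvSet_iff_isUnit hcp).mpr hp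

theorem tendsto_resolv {ι : Type*} {l : Filter ι} {B : ι → H →ₗ.[ℂ] H}
    {B₀ : H →ₗ.[ℂ] H} {c ζ₀ : ℂ} (hc : ∀ᶠ i in l, c ∈ resolvSet (B i)) (hc₀ : c ∈ resolvSet B₀)
    (hlim : Tendsto (fun i => resolv (B i) c) l (𝓝 (resolv B₀ c))) (hζ₀ : ζ₀ ∈ resolvSet B₀) :
    (∀ᶠ i in l, ζ₀ ∈ resolvSet (B i)) ∧
      Tendsto (fun i => resolv (B i) ζ₀) l (𝓝 (resolv B₀ ζ₀)) := by
  have h0 : ∀ᶠ i in l, ζ₀ ∈ resolvSet (B i) :=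
    (eventually_mem_resolvSet_prod hc hc₀ hlim hζ₀).curry.mono fun i hi => hi.self_of_nhds
  refine ⟨h0, ?_⟩
  have h1 : Tendsto (fun i => 1 - (ζ₀ - c) • resolv (B i) c) l
      (𝓝 (1 - (ζ₀ - c) • resolv B₀ c)) := (hlim.const_smul _).const_sub 1
  obtain ⟨v, hv⟩ := isUnit_of_mem_resolvSet hc₀ hζ₀
  have h2 : Tendsto (fun i => Ring.inverse (1 - (ζ₀ - c) • resolv (B i) c)) l
      (𝓝 (Ring.inverse (1 - (ζ₀ - c) • resolv B₀ c))) := by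
    have h3 := NormedRing.inverse_continuousAt v
    rw [hv] at h3
    exact h3.tendsto.comp h1
  have h3 := hlim.mul h2
  rw [← resolv_eq_mul_inverse hc₀ hζ₀] at h3
  refine h3.congr' ?_
  filter_upwards [hc, h0] with i hi hi0 using (resolv_eq_mul_inverse hi hi0).symm

end Resolvents

/-! ### Self-adjoint operators and their resolvents -/

section SelfAdjoint

variable {H : Type*} [NormedAddCommGroup H] [InnerProductSpace ℂ H] [CompleteSpace H]

theorem inner_map_eq_of_isSelfAdjoint {B : H →ₗ.[ℂ] H} (hB : IsSelfAdjoint B) (x y : B.domain) :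
    inner ℂ (B x) (y : H) = inner ℂ (x : H) (B y) := by
  have h := LinearPMap.adjoint_isFormalAdjoint hB.dense_domain
  rw [LinearPMap.isSelfAdjoint_def.mp hB] at h
  exact h x y

theorem mem_domain_of_isSelfAdjoint {B : H →ₗ.[ℂ] H} (hB : IsSelfAdjoint B) {y w : H}
    (h : ∀ x : B.domain, inner ℂ w (x : H) = inner ℂ y (B x)) :
    ∃ hy : y ∈ B.domain, B ⟨y, hy⟩ = w := by
  have h1 : y ∈ B.adjoint.domain := B.mem_adjoint_domain_of_exists y ⟨w, h⟩
  have h2 := LinearPMap.adjoint_apply_eq hB.dense_domain ⟨y, h1⟩ h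
  have h3 := LinearPMap.isSelfAdjoint_def.mp hB
  have key : ∀ C : H →ₗ.[ℂ] H, C = B → (hy : y ∈ C.domain) → C ⟨y, hy⟩ = w →
      ∃ hy : y ∈ B.domain, B ⟨y, hy⟩ = w := by
    rintro _ rfl hy h
    exact ⟨hy, h⟩
  exact key _ h3 h1 h2

theorem isSelfAdjoint_addBdd {B : H →ₗ.[ℂ] H} {V : H →L[ℂ] H} (hB : IsSelfAdjoint B)
    (hV : IsSelfAdjoint V) : IsSelfAdjoint (addBdd B V) := by
  have hVs : ∀ x y : H, inner ℂ (V x) y = inner ℂ x (V y) :=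
    ContinuousLinearMap.isSelfAdjoint_iff_isSymmetric.mp hV
  have hd : Dense ((addBdd B V).domain : Set H) := hB.dense_domain
  rw [LinearPMap.isSelfAdjoint_def]
  symm
  have hle : addBdd B V ≤ (addBdd B V).adjoint := by
    refine LinearPMap.IsFormalAdjoint.le_adjoint hd fun x y => ?_
    rw [addBdd_apply B V x, addBdd_apply B V y, inner_add_left, inner_add_right, hVs]
    exact congrArg _ (inner_map_eq_of_isSelfAdjoint hB x y)
  refine LinearPMap.eq_of_le_of_domain_eq hle (le_antisymm hle.1 fun y hy => ?_)
  have h1 := LinearPMap.adjoint_isFormalAdjoint hd ⟨y, hy⟩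
  obtain ⟨hy', -⟩ := mem_domain_of_isSelfAdjoint hB (y := y)
    (w := (addBdd B V).adjoint ⟨y, hy⟩ - V y) fun x => by
      have h2 := h1 x
      rw [addBdd_apply B V x, inner_add_right] at h2
      rw [inner_sub_left, hVs]
      exact sub_eq_iff_eq_add'.mpr h2
  exact hy'

/-- The form `⟨B x, x⟩` is real, so only `ζ` contributes to the imaginary part of `⟨(B - ζ) x, x⟩`;
Cauchy–Schwarz does the rest. -/
theorem abs_im_mul_norm_le {B : H →ₗ.[ℂ] H} (hB : IsSelfAdjoint B) (ζ : ℂ) (x : B.domain) :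
    |ζ.im| * ‖(x : H)‖ ≤ ‖B x - ζ • (x : H)‖ := by
  have h1 : (inner ℂ (x : H) (B x - ζ • (x : H))).im = -ζ.im * ‖(x : H)‖ ^ 2 := by
    have h2 : (inner ℂ (x : H) (B x)).im = 0 := by
      rw [← Complex.conj_eq_iff_im, inner_conj_symm]
      exact inner_map_eq_of_isSelfAdjoint hB x x
    rw [inner_sub_right, inner_smul_right, Complex.sub_im, h2, inner_self_eq_norm_sq_to_K]
    simp [← Complex.ofReal_pow]
  have h3 : |ζ.im| * ‖(x : H)‖ ^ 2 ≤ ‖(x : H)‖ * ‖B x - ζ • (x : H)‖ := by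
    have h4 : |(inner ℂ (x : H) (B x - ζ • (x : H))).im| = |ζ.im| * ‖(x : H)‖ ^ 2 := by
      rw [h1, abs_mul, abs_neg, abs_of_nonneg (sq_nonneg ‖(x : H)‖)]
    rw [← h4]
    exact (Complex.abs_im_le_norm _).trans (norm_inner_le_norm _ _)
  rcases (norm_nonneg (x : H)).eq_or_lt with h0 | h0
  · rw [← h0, mul_zero]; exact norm_nonneg _
  · nlinarith

/-- On the graph of `B`, complete because `B` is closed, `B - ζ` is a bounded operator that is
bounded below, hence injective with closed range. A vector orthogonal to the range is an eigenvector
for `ζ̄` or zero, and the same bound rules out the former. -/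
theorem mem_resolvSet_of_im_ne_zero {B : H →ₗ.[ℂ] H} (hB : IsSelfAdjoint B) {ζ : ℂ}
    (hζ : ζ.im ≠ 0) : ζ ∈ resolvSet B := by
  have hclosed : IsClosed (B.graph : Set (H × H)) := hB.isClosed
  have : CompleteSpace B.graph := hclosed.completeSpace_coe
  let Φ : B.graph →L[ℂ] H := (ContinuousLinearMap.snd ℂ H H - ζ • ContinuousLinearMap.fst ℂ H H) ∘L
    B.graph.subtypeL
  have hΦ : ∀ p : B.graph, ∃ x : B.domain, (x : H) = p.1.1 ∧ B x = p.1.2 ∧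
      Φ p = B x - ζ • (x : H) := by
    intro p
    obtain ⟨x, h1, h2⟩ := (LinearPMap.mem_graph_iff B).mp p.2
    refine ⟨x, h1, h2, ?_⟩
    rw [h1, h2]
    rfl
  have him : 0 < |ζ.im| := abs_pos.mpr hζ
  have hb1 : ∀ p : B.graph, ‖p.1.1‖ ≤ |ζ.im|⁻¹ * ‖Φ p‖ := by
    intro p
    obtain ⟨x, h1, h2, h3⟩ := hΦ p
    rw [h3, ← h1, le_inv_mul_iff₀ him]
    exact abs_im_mul_norm_le hB ζ x
  have hanti : AntilipschitzWith (1 + (‖ζ‖₊ + 1) * (Real.nnabs ζ.im)⁻¹) Φ := by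
    refine ContinuousLinearMap.antilipschitz_of_bound _ fun p => ?_
    have h1 := hb1 p
    have h2 : ‖p.1.2‖ ≤ ‖Φ p‖ + ‖ζ‖ * ‖p.1.1‖ := by
      have h3 : p.1.2 = Φ p + ζ • p.1.1 := by
        show p.1.2 = p.1.2 - ζ • p.1.1 + ζ • p.1.1
        abel
      conv_lhs => rw [h3]
      exact (norm_add_le _ _).trans (by rw [norm_smul])
    have h4 : 0 ≤ |ζ.im|⁻¹ * ‖Φ p‖ := by positivity
    have h5 := mul_le_mul_of_nonneg_left h1 (norm_nonneg ζ)
    push_cast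
    have h6 : 0 ≤ ‖ζ‖ * (|ζ.im|⁻¹ * ‖Φ p‖) := by positivity
    have h7 := norm_nonneg (Φ p)
    refine max_le ?_ ?_
    · show ‖p.1.1‖ ≤ _
      nlinarith
    · show ‖p.1.2‖ ≤ _
      nlinarith
  have hsurj : Φ.range = ⊤ := by
    have hcl : IsClosed (Φ.range : Set H) := hanti.isClosed_range Φ.uniformContinuous
    have horth : Φ.rangeᗮ = ⊥ := by
      rw [eq_bot_iff]
      intro y hy
      obtain ⟨hy', hBy⟩ := mem_domain_of_isSelfAdjoint hB (y := y) (w := star ζ • y) fun x => by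
        have h1 : inner ℂ y (B x - ζ • (x : H)) = 0 :=
          Submodule.inner_left_of_mem_orthogonal (K := Φ.range)
            ⟨⟨(x, B x), B.mem_graph x⟩, rfl⟩ hy
        rw [inner_sub_right, inner_smul_right, sub_eq_zero] at h1
        rw [inner_smul_left, h1]
        simp
      have h2 := abs_im_mul_norm_le hB (star ζ) ⟨y, hy'⟩
      rw [hBy, sub_self, norm_zero] at h2
      have h3 : |(star ζ).im| = |ζ.im| := by simp
      rw [h3] at h2
      have h4 : ‖y‖ = 0 := by
        have := norm_nonneg y
        have h2' : |ζ.im| * ‖y‖ ≤ 0 := h2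
        nlinarith
      exact norm_eq_zero.mp h4
    have h1 := Submodule.topologicalClosure_eq_top_iff.mpr horth
    rwa [hcl.submodule_topologicalClosure_eq] at h1
  let e := ContinuousLinearEquiv.ofBijective Φ (LinearMap.ker_eq_bot.mpr hanti.injective) hsurj
  refine ⟨ContinuousLinearMap.fst ℂ H H ∘L B.graph.subtypeL ∘L e.symm.toContinuousLinearMap,
    fun v => ?_, fun x => ?_⟩
  · obtain ⟨x, h1, h2, h3⟩ := hΦ (e.symm v)
    have h4 : Φ (e.symm v) = v := e.apply_symm_apply v
    have hx : (e.symm v).1.1 ∈ B.domain := h1 ▸ x.2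
    refine ⟨hx, ?_⟩
    have h5 : (⟨(e.symm v).1.1, hx⟩ : B.domain) = x := Subtype.ext h1.symm
    have h6 : B ⟨(e.symm v).1.1, hx⟩ - ζ • (e.symm v).1.1 = v := by
      rw [h5, ← h1, ← h3, h4]
    exact h6
  · have h1 : e ⟨(x, B x), B.mem_graph x⟩ = B x - ζ • (x : H) := rfl
    show (e.symm (B x - ζ • (x : H))).1.1 = x
    rw [← h1, e.symm_apply_apply]

theorem norm_resolv_le {B : H →ₗ.[ℂ] H} (hB : IsSelfAdjoint B) {ζ : ℂ} (hζ : ζ.im ≠ 0) :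
    ‖resolv B ζ‖ ≤ |ζ.im|⁻¹ := by
  have hmem := mem_resolvSet_of_im_ne_zero hB hζ
  refine ContinuousLinearMap.opNorm_le_bound _ (by positivity) fun v => ?_
  have h1 := abs_im_mul_norm_le hB ζ ⟨resolv B ζ v, resolv_apply_mem hmem v⟩
  rw [apply_resolv hmem, add_sub_cancel_right] at h1
  rwa [le_inv_mul_iff₀ (abs_pos.mpr hζ)]

theorem isResolvent_adjoint {B : H →ₗ.[ℂ] H} (hB : IsSelfAdjoint B) {ζ : ℂ}
    (hζ : ζ ∈ resolvSet B) : IsResolvent B (star ζ) ((resolv B ζ)†) := by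
  refine ⟨fun v => ?_, fun x => ?_⟩
  · obtain ⟨h1, h2⟩ := mem_domain_of_isSelfAdjoint hB (y := ((resolv B ζ)†) v)
      (w := v + star ζ • ((resolv B ζ)†) v) fun x => by
        have h3 := (resolv_spec hζ).2 x
        rw [ContinuousLinearMap.adjoint_inner_left, inner_add_left, inner_smul_left,
          ContinuousLinearMap.adjoint_inner_left, ← inner_smul_right, ← inner_add_right]
        congr 1
        rw [map_sub, map_smul, sub_eq_iff_eq_add] at h3
        rw [h3]
        simp
    exact ⟨h1, by rw [h2, add_sub_cancel_right]⟩
  · refine ext_inner_right ℂ fun v => ?_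
    rw [ContinuousLinearMap.adjoint_inner_left, inner_sub_left, inner_smul_left]
    have h1 := inner_map_eq_of_isSelfAdjoint hB x ⟨resolv B ζ v, resolv_apply_mem hζ v⟩
    rw [apply_resolv hζ, inner_add_right, inner_smul_right] at h1
    have h2 : (starRingEnd ℂ) (star ζ) = ζ := by simp
    rw [h2, sub_eq_iff_eq_add]
    exact h1

theorem star_mem_resolvSet {B : H →ₗ.[ℂ] H} (hB : IsSelfAdjoint B) {ζ : ℂ}
    (hζ : ζ ∈ resolvSet B) : star ζ ∈ resolvSet B := (isResolvent_adjoint hB hζ).mem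

theorem resolv_star {B : H →ₗ.[ℂ] H} (hB : IsSelfAdjoint B) {ζ : ℂ}
    (hζ : ζ ∈ resolvSet B) : resolv B (star ζ) = (resolv B ζ)† :=
  (isResolvent_adjoint hB hζ).resolv_eq

theorem isSelfAdjoint_resolv {B : H →ₗ.[ℂ] H} (hB : IsSelfAdjoint B) {c : ℝ}
    (hc : (c : ℂ) ∈ resolvSet B) : IsSelfAdjoint (resolv B (c : ℂ)) := by
  have h := resolv_star hB hc
  rw [Complex.star_def, Complex.conj_ofReal] at h
  exact h.symm

end SelfAdjoint

/-! ### Symplectic algebra of the Lagrangian planes -/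

section Kernels

theorem Pair.ext {K : Type*} {f g : Pair K} (h1 : f.fst = g.fst) (h2 : f.snd = g.snd) : f = g :=
  (WithLp.equiv 2 (K × K)).injective (Prod.ext h1 h2)

variable {K : Type*} [NormedAddCommGroup K] [InnerProductSpace ℂ K]

theorem row_apply {E : Type*} [NormedAddCommGroup E] [NormedSpace ℂ E] (A B : K →L[ℂ] E)
    (f : Pair K) : row A B f = A f.fst + B f.snd := rfl

theorem col_fst {E : Type*} [NormedAddCommGroup E] [NormedSpace ℂ E] (A B : E →L[ℂ] K) (x : E) :
    (col A B x).fst = A x := rfl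

theorem col_snd {E : Type*} [NormedAddCommGroup E] [NormedSpace ℂ E] (A B : E →L[ℂ] K) (x : E) :
    (col A B x).snd = B x := rfl

theorem inner_opJ (f g : Pair K) : inner ℂ g (opJ K f) = omega f g := by
  rw [WithLp.prod_inner_apply, omega]
  show inner ℂ g.fst f.snd + inner ℂ g.snd (-f.fst) = _
  rw [inner_neg_right, sub_eq_add_neg]

/-- With `J² = -1` playing the role of the imaginary unit, this is the multiplication of `X + J Y`
and `X' + J Y'`. -/
theorem opM_mul (X Y X' Y' : K →L[ℂ] K) :
    opM X Y * opM X' Y' = opM (X * X' - Y * Y') (X * Y' + Y * X') := by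
  ext f
  refine Pair.ext ?_ ?_
  · simp only [mul_apply_eq_comp, opM, col_fst, col_snd, row_apply, map_add, neg_apply, map_neg,
      add_apply, sub_apply]
    abel
  · simp only [mul_apply_eq_comp, opM, col_fst, col_snd, row_apply, map_add, neg_apply, map_neg,
      add_apply, sub_apply]
    abel

theorem isUnit_of_isUnit_opM_zero [CompleteSpace K] {S : K →L[ℂ] K} (h : IsUnit (opM S 0)) :
    IsUnit S := by
  rw [ContinuousLinearMap.isUnit_iff_bijective] at h ⊢
  have hS : ∀ a b : K, opM S 0 (WithLp.toLp 2 (a, b)) = WithLp.toLp 2 (S a, S b) := by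
    intro a b
    refine Pair.ext ?_ ?_ <;> simp [opM, col_fst, col_snd, row_apply]
  refine ⟨fun a b hab => ?_, fun a => ?_⟩
  · have h1 : (WithLp.toLp 2 (a, a) : Pair K) = WithLp.toLp 2 (b, b) :=
      h.1 (by rw [hS, hS, hab])
    exact congrArg WithLp.fst h1
  · obtain ⟨f, hf⟩ := h.2 (WithLp.toLp 2 (a, a))
    refine ⟨f.fst, ?_⟩
    have h1 := congrArg WithLp.fst hf
    simpa [opM, col_fst, row_apply] using h1

theorem isUnit_opM {X Y : K →L[ℂ] K} (h : (0 : ℂ) ∉ spectrum ℂ (opM X Y)) : IsUnit (opM X Y) := by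
  exact (spectrum.zero_notMem_iff ℂ).mp h

variable [CompleteSpace K]

theorem adjoint_opM (X Y : K →L[ℂ] K) : (opM X Y)† = opM (X†) (-Y†) := by
  symm
  rw [ContinuousLinearMap.eq_adjoint_iff]
  intro f g
  simp only [WithLp.prod_inner_apply]
  show inner ℂ ((X†) f.fst + (-Y†) f.snd) g.fst + inner ℂ ((-(-Y†)) f.fst + (X†) f.snd) g.snd =
    inner ℂ f.fst (X g.fst + Y g.snd) + inner ℂ f.snd ((-Y) g.fst + X g.snd)
  simp only [inner_add_left, inner_add_right, neg_apply, inner_neg_left, inner_neg_right, neg_neg,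
    ContinuousLinearMap.adjoint_inner_left]
  ring

theorem opM_mul_adjoint {X Y : K →L[ℂ] K} (h : X ∘L Y† = Y ∘L X†) :
    opM X Y * (opM X Y)† = opM (X ∘L X† + Y ∘L Y†) 0 := by
  rw [adjoint_opM, opM_mul]
  congr 1
  · ext v; simp
  · ext v
    have := congrArg (fun f : K →L[ℂ] K => f v) h
    simp only [ContinuousLinearMap.comp_apply] at this
    simp [this]

theorem isUnit_gram {X Y : K →L[ℂ] K} (h : X ∘L Y† = Y ∘L X†)
    (h0 : (0 : ℂ) ∉ spectrum ℂ (opM X Y)) : IsUnit (X ∘L X† + Y ∘L Y†) := by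
  refine isUnit_of_isUnit_opM_zero ?_
  rw [← opM_mul_adjoint h]
  exact (isUnit_opM h0).mul (isUnit_opM h0).star

theorem opW_eq_of_eq {X Y : K →L[ℂ] K} (h : X ∘L Y† = Y ∘L X†)
    (h0 : (0 : ℂ) ∉ spectrum ℂ (opM X Y)) {f : Pair K} {ψ : K} (h1 : f.fst = -(Y†) ψ)
    (h2 : f.snd = (X†) ψ) : opW X Y f = ψ := by
  have hu := Ring.inverse_mul_cancel _ (isUnit_gram h h0)
  have h3 : row (-Y) X f = (X ∘L X† + Y ∘L Y†) ψ := by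
    rw [row_apply, h1, h2]
    simp [add_comm]
  rw [opW, ContinuousLinearMap.comp_apply, h3]
  exact congrArg (fun g : K →L[ℂ] K => g ψ) hu

/-- Let `M` be the block operator. Since `M M*` is block diagonal with entries `X X* + Y Y*`, for
`f` in the kernel one has `M f = M M* (0, ψ)` with `ψ = W f`. Cancelling `M` leaves `f = M* (0, ψ) =
(-Y* ψ, X* ψ)`. -/
theorem eq_of_mem_ker_row {X Y : K →L[ℂ] K} (h : X ∘L Y† = Y ∘L X†)
    (h0 : (0 : ℂ) ∉ spectrum ℂ (opM X Y)) {f : Pair K} (hf : row X Y f = 0) :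
    f.fst = -(Y†) (opW X Y f) ∧ f.snd = (X†) (opW X Y f) := by
  set S := X ∘L X† + Y ∘L Y† with hS
  have hu : S * Ring.inverse S = 1 := Ring.mul_inverse_cancel _ (isUnit_gram h h0)
  set ψ := Ring.inverse S (row (-Y) X f) with hψ
  have hSψ : S ψ = row (-Y) X f := congrArg (fun g : K →L[ℂ] K => g (row (-Y) X f)) hu
  have hM : opM X Y f = opM X Y (((opM X Y)†) (WithLp.toLp 2 (0, ψ))) := by
    have h1 := congrArg (fun g : Pair K →L[ℂ] Pair K => g (WithLp.toLp 2 (0, ψ)))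
      (opM_mul_adjoint h)
    simp only [mul_apply_eq_comp] at h1
    rw [h1]
    refine Pair.ext ?_ ?_
    · simp [opM, col_fst, row_apply] at hf ⊢
      exact hf
    · simp only [opM, col_snd, ← hSψ, hS]
      simp [row_apply]
  have hfe := (ContinuousLinearMap.isUnit_iff_bijective.mp (isUnit_opM h0)).1 hM
  have h1 : f.fst = -(Y†) ψ := by
    rw [hfe, adjoint_opM]; simp [opM, col_fst, row_apply]
  have h2 : f.snd = (X†) ψ := by
    rw [hfe, adjoint_opM]; simp [opM, col_snd, row_apply]
  rw [opW_eq_of_eq h h0 h1 h2]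
  exact ⟨h1, h2⟩

/-- On the Lagrangian planes, the symplectic form is given by the operators `Z`. -/
theorem inner_opZ {X₂ Y₂ X₁ Y₁ : K →L[ℂ] K} (h₂ : X₂ ∘L Y₂† = Y₂ ∘L X₂†)
    (h₂0 : (0 : ℂ) ∉ spectrum ℂ (opM X₂ Y₂)) (h₁ : X₁ ∘L Y₁† = Y₁ ∘L X₁†)
    (h₁0 : (0 : ℂ) ∉ spectrum ℂ (opM X₁ Y₁)) {f g : Pair K} (hf : row X₁ Y₁ f = 0)
    (hg : row X₂ Y₂ g = 0) : inner ℂ g (opZ X₂ Y₂ X₁ Y₁ f) = omega f g := by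
  obtain ⟨hf1, hf2⟩ := eq_of_mem_ker_row h₁ h₁0 hf
  obtain ⟨hg1, hg2⟩ := eq_of_mem_ker_row h₂ h₂0 hg
  rw [omega, hg1, hg2, hf1, hf2, opZ, ContinuousLinearMap.comp_apply,
    ContinuousLinearMap.adjoint_inner_right]
  simp only [ContinuousLinearMap.comp_apply, sub_apply, inner_sub_right, inner_neg_left,
    inner_neg_right, ContinuousLinearMap.adjoint_inner_left]
  ring

end Kernels

/-! ### Krein's formula for the family -/

section Families

variable {H K D : Type*}
  [NormedAddCommGroup H] [InnerProductSpace ℂ H] [CompleteSpace H]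
  [NormedAddCommGroup K] [InnerProductSpace ℂ K] [CompleteSpace K]
  [NormedAddCommGroup D] [NormedSpace ℂ D]
  {A : H →ₗ.[ℂ] H} {j : D →L[ℂ] HPlus A}

theorem emb_injective (hj : Function.Injective j) : Function.Injective (emb j) := by
  intro a b hab
  obtain ⟨ha, ha'⟩ := adjPlus_eq A (j a)
  obtain ⟨hb, hb'⟩ := adjPlus_eq A (j b)
  have h1 : inclPlus A (j a) = inclPlus A (j b) := hab
  have h2 : adjPlus A (j a) = adjPlus A (j b) := by
    rw [← ha', ← hb']
    congr 2
  exact hj (Subtype.ext ((WithLp.equiv 2 (H × H)).injective (Prod.ext h1 h2)))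

/-- A self-adjoint extension of `A` is a restriction of `A*`. -/
theorem adjPlus_eq_apply (hA : Dense (A.domain : Set H)) {B : H →ₗ.[ℂ] H} (hB : IsSelfAdjoint B)
    (hAB : A ≤ B) {d : D} (hd : emb j d ∈ B.domain) : adjPlus A (j d) = B ⟨emb j d, hd⟩ := by
  obtain ⟨h, h'⟩ := adjPlus_eq A (j d)
  rw [← h']
  refine LinearPMap.adjoint_apply_eq hA _ fun x => ?_
  have hx : (x : H) ∈ B.domain := hAB.1 x.2
  have h1 : A x = B ⟨x, hx⟩ := hAB.2 rfl
  rw [h1]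
  exact inner_map_eq_of_isSelfAdjoint hB ⟨emb j d, hd⟩ ⟨x, hx⟩

variable {T : ℝ → D →L[ℂ] Pair K} {Q : ℝ → Pair K →L[ℂ] Pair K} {𝒜 : ℝ → H →ₗ.[ℂ] H}
  {V : ℝ → H →L[ℂ] H} {X Y : ℝ → K →L[ℂ] K}

theorem IsFamily.isSelfAdjoint (hfam : IsFamily j T Q 𝒜 V) {t : ℝ} (ht : t ∈ Set.Icc (0 : ℝ) 1) :
    IsSelfAdjoint (addBdd (𝒜 t) (V t)) :=
  isSelfAdjoint_addBdd (hfam.selfAdjoint t ht) (hfam.selfAdjoint_V t ht)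

theorem IsFamily.row_trace_eq_zero (hfam : IsFamily j T Q 𝒜 V) (hker : IsKernelFamily Q X Y) {t : ℝ}
    (ht : t ∈ Set.Icc (0 : ℝ) 1) {d : D} (hd : emb j d ∈ (𝒜 t).domain) :
    row (X t) (Y t) (T t d) = 0 := by
  have h1 : T t d ∈ closure (T t '' {d : D | emb j d ∈ (𝒜 t).domain}) :=
    subset_closure ⟨d, hd, rfl⟩
  rw [hfam.closure_trace t ht, hker.range_eq t ht] at h1
  exact h1

variable [CompleteSpace D]

theorem IsFamily.emb_resolvD (hfam : IsFamily j T Q 𝒜 V) {t : ℝ} (ht : t ∈ Set.Icc (0 : ℝ) 1)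
    {ζ : ℂ} (hζ : ζ ∈ resolvSet (addBdd (𝒜 t) (V t))) (v : H) :
    emb j (resolvD j (addBdd (𝒜 t) (V t)) ζ v) = resolv (addBdd (𝒜 t) (V t)) ζ v :=
  resolvD_spec (B := addBdd (𝒜 t) (V t)) hfam.traceDomain.injective
    (fun x hx => hfam.domain_sub t ht x hx) hζ v

theorem IsFamily.emb_resolvD_mem (hfam : IsFamily j T Q 𝒜 V) {t : ℝ} (ht : t ∈ Set.Icc (0 : ℝ) 1)
    {ζ : ℂ} (hζ : ζ ∈ resolvSet (addBdd (𝒜 t) (V t))) (v : H) :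
    emb j (resolvD j (addBdd (𝒜 t) (V t)) ζ v) ∈ (𝒜 t).domain := by
  rw [hfam.emb_resolvD ht hζ]
  exact resolv_apply_mem hζ v

theorem IsFamily.adjPlus_resolvD (hfam : IsFamily j T Q 𝒜 V) {t : ℝ} (ht : t ∈ Set.Icc (0 : ℝ) 1)
    {ζ : ℂ} (hζ : ζ ∈ resolvSet (addBdd (𝒜 t) (V t))) (v : H) :
    adjPlus A (j (resolvD j (addBdd (𝒜 t) (V t)) ζ v)) =
      v + ζ • resolv (addBdd (𝒜 t) (V t)) ζ v - V t (resolv (addBdd (𝒜 t) (V t)) ζ v) := by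
  rw [adjPlus_eq_apply hfam.traceDomain.dense_domain (hfam.selfAdjoint t ht) (hfam.extends_A t ht)
    (hfam.emb_resolvD_mem ht hζ v), ← apply_resolv hζ v, eq_sub_iff_add_eq, add_comm]
  rw [addBdd_mk]
  congr 2
  exact Subtype.ext (hfam.emb_resolvD ht hζ v)

theorem IsFamily.krein (hfam : IsFamily j T Q 𝒜 V) (hker : IsKernelFamily Q X Y) {t s : ℝ}
    (ht : t ∈ Set.Icc (0 : ℝ) 1) (hs : s ∈ Set.Icc (0 : ℝ) 1) {ζ : ℂ}
    (hζt : ζ ∈ resolvSet (addBdd (𝒜 t) (V t))) (hζs : ζ ∈ resolvSet (addBdd (𝒜 s) (V s))) :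
    resolv (addBdd (𝒜 t) (V t)) ζ - resolv (addBdd (𝒜 s) (V s)) ζ =
      resolv (addBdd (𝒜 t) (V t)) ζ ∘L (V s - V t) ∘L resolv (addBdd (𝒜 s) (V s)) ζ
      + (T t ∘L resolvD j (addBdd (𝒜 t) (V t)) (star ζ))† ∘L opZ (X t) (Y t) (X s) (Y s) ∘L
          T s ∘L resolvD j (addBdd (𝒜 s) (V s)) ζ
      + (T t ∘L resolvD j (addBdd (𝒜 t) (V t)) (star ζ))† ∘L opJ K ∘L (T t - T s) ∘L
          resolvD j (addBdd (𝒜 s) (V s)) ζ := by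
  have hζ' := star_mem_resolvSet (hfam.isSelfAdjoint ht) hζt
  have hadj : ∀ x y : H, inner ℂ y (resolv (addBdd (𝒜 t) (V t)) ζ x) =
      inner ℂ (resolv (addBdd (𝒜 t) (V t)) (star ζ) y) x := fun x y => by
    rw [resolv_star (hfam.isSelfAdjoint ht) hζt, ContinuousLinearMap.adjoint_inner_left]
  have hV : ∀ x y : H, inner ℂ (V t x) y = inner ℂ x (V t y) :=
    ContinuousLinearMap.isSelfAdjoint_iff_isSymmetric.mp (hfam.selfAdjoint_V t ht)
  ext h
  refine ext_inner_left ℂ fun k => ?_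
  set u := resolvD j (addBdd (𝒜 s) (V s)) ζ h with hu
  set v := resolvD j (addBdd (𝒜 t) (V t)) (star ζ) k with hv
  have hue : resolv (addBdd (𝒜 s) (V s)) ζ h = emb j u := (hfam.emb_resolvD hs hζs h).symm
  have hve : resolv (addBdd (𝒜 t) (V t)) (star ζ) k = emb j v :=
    (hfam.emb_resolvD ht hζ' k).symm
  have hua := hfam.adjPlus_resolvD hs hζs h
  have hva := hfam.adjPlus_resolvD ht hζ' k
  rw [← hu, hue] at hua
  rw [← hv, hve] at hva
  -- Green's identity is used with `T t` for both vectors, although `u` belongs to the domain at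
  -- `s`. The mismatch on `u` is the source of the term with `J (T t - T s)`.
  have hgreen := (hfam.traceOp t ht).green u v
  have hZ := inner_opZ (hker.comm t ht) (hker.invertible t ht) (hker.comm s hs)
    (hker.invertible s hs) (hfam.row_trace_eq_zero hker hs (hfam.emb_resolvD_mem hs hζs h))
    (hfam.row_trace_eq_zero hker ht (hfam.emb_resolvD_mem ht hζ' k))
  rw [← hu, ← hv] at hZ
  have hJ := inner_opJ (T t u - T s u) (T t v)
  have hom : omega (T t u - T s u) (T t v) = omega (T t u) (T t v) - omega (T s u) (T t v) := by
    simp only [omega, WithLp.sub_fst, WithLp.sub_snd, inner_sub_right]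
    ring
  simp only [add_apply, sub_apply, ContinuousLinearMap.comp_apply, inner_add_right,
    inner_sub_right, hadj, ContinuousLinearMap.adjoint_inner_right]
  rw [← hu, ← hv, hue, hve, hZ, hJ, hom, ← hgreen, hua, hva]
  simp only [inner_add_right, inner_sub_right, inner_add_left, inner_sub_left, inner_smul_left,
    inner_smul_right, hV, Complex.star_def, Complex.conj_conj]
  ring

/-- The resolvent of `𝒜_t + V_t` as an operator into `D`, in terms of `(𝒜_t - i)⁻¹`. -/
theorem IsFamily.resolvD_eq (hfam : IsFamily j T Q 𝒜 V) {t : ℝ} (ht : t ∈ Set.Icc (0 : ℝ) 1)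
    {ζ : ℂ} (hζ : ζ ∈ resolvSet (addBdd (𝒜 t) (V t))) :
    resolvD j (addBdd (𝒜 t) (V t)) ζ = resolvD j (𝒜 t) Complex.I ∘L
      (1 + ((ζ - Complex.I) • 1 - V t) ∘L resolv (addBdd (𝒜 t) (V t)) ζ) := by
  have hI : Complex.I ∈ resolvSet (𝒜 t) :=
    mem_resolvSet_of_im_ne_zero (hfam.selfAdjoint t ht) (by simp)
  ext v
  refine emb_injective hfam.traceDomain.injective ?_
  rw [ContinuousLinearMap.comp_apply, hfam.emb_resolvD ht hζ,
    resolvD_spec hfam.traceDomain.injective (hfam.domain_sub t ht) hI]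
  have h1 := (resolv_spec hI).2 ⟨resolv (addBdd (𝒜 t) (V t)) ζ v, resolv_apply_mem hζ v⟩
  have h2 := apply_resolv hζ v
  rw [addBdd_mk] at h2
  refine h1.symm.trans (congrArg _ ?_)
  rw [← eq_sub_iff_add_eq'] at h2
  rw [h2]
  simp only [add_apply, one_apply_eq_self, ContinuousLinearMap.comp_apply, sub_apply, smul_apply]
  module

end Families

/-! ### Limits and derivatives of products of operators -/

section OperatorLimits

variable {ι E F G : Type*} [NormedAddCommGroup E] [NormedSpace ℂ E] [NormedAddCommGroup F]
  [NormedSpace ℂ F] [NormedAddCommGroup G] [NormedSpace ℂ G] {l : Filter ι}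

theorem tendsto_comp {f : ι → F →L[ℂ] G} {g : ι → E →L[ℂ] F} {a : F →L[ℂ] G} {b : E →L[ℂ] F}
    (hf : Tendsto f l (𝓝 a)) (hg : Tendsto g l (𝓝 b)) :
    Tendsto (fun i => f i ∘L g i) l (𝓝 (a ∘L b)) :=
  (isBoundedBilinearMap_comp (𝕜 := ℂ) |>.continuous.tendsto (a, b)).comp (hf.prodMk_nhds hg)

theorem isBigO_comp {f : ι → F →L[ℂ] G} {g : ι → E →L[ℂ] F}
    (hf : f =O[l] fun _ => (1 : ℝ)) (hg : g =O[l] fun _ => (1 : ℝ)) :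
    (fun i => f i ∘L g i) =O[l] fun _ => (1 : ℝ) := by
  have h1 := hf.norm_left.mul hg.norm_left
  simp only [mul_one] at h1
  refine (Asymptotics.IsBigO.of_bound 1 (.of_forall fun i => ?_)).trans h1
  rw [one_mul, Real.norm_eq_abs, abs_of_nonneg (by positivity)]
  exact (f i).opNorm_comp_le (g i)

theorem tendsto_zero_comp {f : ι → F →L[ℂ] G} {g : ι → E →L[ℂ] F}
    (hf : f =O[l] fun _ => (1 : ℝ)) (hg : Tendsto g l (𝓝 0)) :
    Tendsto (fun i => f i ∘L g i) l (𝓝 0) := by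
  rw [← Asymptotics.isLittleO_one_iff ℝ] at hg ⊢
  have h1 := hf.norm_left.mul_isLittleO hg.norm_left
  simp only [mul_one] at h1
  refine (Asymptotics.IsBigO.of_bound 1 (.of_forall fun i => ?_)).trans_isLittleO h1
  rw [one_mul, Real.norm_eq_abs, abs_of_nonneg (by positivity)]
  exact (f i).opNorm_comp_le (g i)

theorem tendsto_zero_comp_const {f : ι → F →L[ℂ] G} (q : E →L[ℂ] F) (hf : Tendsto f l (𝓝 0)) :
    Tendsto (fun i => f i ∘L q) l (𝓝 0) := by
  simpa using tendsto_comp hf (tendsto_const_nhds (x := q))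

/-- As `g t₀ = 0`, the slope of the product is `f t` times the slope of `g`, so `f` needs a limit
but no derivative. -/
theorem hasDerivWithinAt_comp_of_eq_zero {s : Set ℝ} {t₀ : ℝ} {f : ℝ → F →L[ℂ] G}
    {g : ℝ → E →L[ℂ] F} {a : F →L[ℂ] G} {g' : E →L[ℂ] F} (hf : Tendsto f (𝓝[s] t₀) (𝓝 a))
    (hg : HasDerivWithinAt g g' s t₀) (hg₀ : g t₀ = 0) :
    HasDerivWithinAt (fun t => f t ∘L g t) (a ∘L g') s t₀ := by
  rw [hasDerivWithinAt_iff_tendsto_slope] at hg ⊢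
  refine (tendsto_comp (hf.mono_left (nhdsWithin_mono _ Set.sdiff_subset)) hg).congr fun t => ?_
  simp only [slope_def_module, hg₀, ContinuousLinearMap.comp_zero, sub_zero]
  ext v
  simp only [ContinuousLinearMap.comp_apply, smul_apply, ← Complex.coe_smul, map_smul]

theorem hasDerivWithinAt_comp_const {s : Set ℝ} {t₀ : ℝ} {f : ℝ → F →L[ℂ] G} {f' : F →L[ℂ] G}
    (hf : HasDerivWithinAt f f' s t₀) (q : E →L[ℂ] F) :
    HasDerivWithinAt (fun t => f t ∘L q) (f' ∘L q) s t₀ := by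
  rw [hasDerivWithinAt_iff_tendsto_slope] at hf ⊢
  refine (tendsto_comp hf (tendsto_const_nhds (x := q))).congr fun t => ?_
  simp only [slope_def_module]
  ext v
  simp

theorem hasDerivWithinAt_const_comp {s : Set ℝ} {t₀ : ℝ} {f : ℝ → E →L[ℂ] F} {f' : E →L[ℂ] F}
    (p : F →L[ℂ] G) (hf : HasDerivWithinAt f f' s t₀) :
    HasDerivWithinAt (fun t => p ∘L f t) (p ∘L f') s t₀ := by
  rw [hasDerivWithinAt_iff_tendsto_slope] at hf ⊢
  refine (tendsto_comp (tendsto_const_nhds (x := p)) hf).congr fun t => ?_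
  simp only [slope_def_module]
  ext v
  simp only [ContinuousLinearMap.comp_apply, smul_apply, sub_apply, ← Complex.coe_smul, map_smul,
    map_sub]

end OperatorLimits

/-! ### Limits and derivatives of adjoints -/

section AdjointLimits

variable {ι E F : Type*} [NormedAddCommGroup E] [InnerProductSpace ℂ E] [CompleteSpace E]
  [NormedAddCommGroup F] [InnerProductSpace ℂ F] [CompleteSpace F] {l : Filter ι}

theorem tendsto_adjoint {f : ι → E →L[ℂ] F} {a : E →L[ℂ] F} (hf : Tendsto f l (𝓝 a)) :
    Tendsto (fun i => (f i)†) l (𝓝 (a†)) :=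
  ((ContinuousLinearMap.adjoint (𝕜 := ℂ) (E := E) (F := F)).continuous.tendsto a).comp hf

theorem isBigO_adjoint {f : ι → E →L[ℂ] F} (hf : f =O[l] fun _ => (1 : ℝ)) :
    (fun i => (f i)†) =O[l] fun _ => (1 : ℝ) := by
  refine (Asymptotics.IsBigO.of_bound 1 (.of_forall fun i => ?_)).trans hf
  rw [one_mul, LinearIsometryEquiv.norm_map]

theorem hasDerivWithinAt_adjoint {s : Set ℝ} {t₀ : ℝ} {f : ℝ → E →L[ℂ] F} {f' : E →L[ℂ] F}
    (hf : HasDerivWithinAt f f' s t₀) : HasDerivWithinAt (fun t => (f t)†) (f'†) s t₀ := by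
  rw [hasDerivWithinAt_iff_tendsto_slope] at hf ⊢
  refine (tendsto_adjoint hf).congr fun t => ?_
  simp only [slope_def_module, ← Complex.coe_smul, map_smulₛₗ, map_sub, Complex.conj_ofReal]

theorem tendsto_opW {X Y : ι → F →L[ℂ] F} {X₀ Y₀ : F →L[ℂ] F} (hX : Tendsto X l (𝓝 X₀))
    (hY : Tendsto Y l (𝓝 Y₀)) (hu : IsUnit (X₀ ∘L X₀† + Y₀ ∘L Y₀†)) :
    Tendsto (fun i => opW (X i) (Y i)) l (𝓝 (opW X₀ Y₀)) := by
  have h1 := (tendsto_comp hX (tendsto_adjoint hX)).add (tendsto_comp hY (tendsto_adjoint hY))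
  have h2 : Tendsto (fun i => Ring.inverse (X i ∘L (X i)† + Y i ∘L (Y i)†)) l
      (𝓝 (Ring.inverse (X₀ ∘L X₀† + Y₀ ∘L Y₀†))) := by
    obtain ⟨v, hv⟩ := hu
    have h3 := NormedRing.inverse_continuousAt v
    rw [hv] at h3
    exact h3.tendsto.comp h1
  exact tendsto_comp h2 ((tendsto_comp hY.neg tendsto_const_nhds).add
    (tendsto_comp hX tendsto_const_nhds))

end AdjointLimits

/-! ### Continuity of the resolvents and the Riccati equation -/

section Continuity

variable {H K D : Type*}
  [NormedAddCommGroup H] [InnerProductSpace ℂ H] [CompleteSpace H]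
  [NormedAddCommGroup K] [InnerProductSpace ℂ K] [CompleteSpace K]
  [NormedAddCommGroup D] [NormedSpace ℂ D]
  {A : H →ₗ.[ℂ] H} {j : D →L[ℂ] HPlus A}
  {T : ℝ → D →L[ℂ] Pair K} {Q : ℝ → Pair K →L[ℂ] Pair K} {𝒜 : ℝ → H →ₗ.[ℂ] H}
  {V : ℝ → H →L[ℂ] H} {X Y : ℝ → K →L[ℂ] K}

theorem ResolventContinuous.tendsto {t₀ : ℝ} (h : ResolventContinuous j 𝒜 t₀) :
    Tendsto (fun t => resolvD j (𝒜 t) Complex.I) (𝓝[Set.Icc 0 1] t₀)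
      (𝓝 (resolvD j (𝒜 t₀) Complex.I)) := by
  rw [ResolventContinuous, Asymptotics.isLittleO_one_iff] at h
  exact tendsto_sub_nhds_zero_iff.mp h

variable [CompleteSpace D]

theorem IsFamily.tendsto_resolv_of_im_ne_zero (hfam : IsFamily j T Q 𝒜 V)
    (hker : IsKernelFamily Q X Y) {t₀ : ℝ} (ht₀ : t₀ ∈ Set.Icc (0 : ℝ) 1)
    (hb : ResolventBounded j 𝒜 t₀) (hT : Continuous01 T t₀) (hV : Continuous01 V t₀)
    (hX : Continuous01 X t₀) (hY : Continuous01 Y t₀) {ζ : ℂ} (hζ : ζ.im ≠ 0) :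
    Tendsto (fun t => resolv (addBdd (𝒜 t) (V t)) ζ) (𝓝[Set.Icc 0 1] t₀)
      (𝓝 (resolv (addBdd (𝒜 t₀) (V t₀)) ζ)) := by
  have hmem : ∀ᶠ t in 𝓝[Set.Icc 0 1] t₀, t ∈ Set.Icc (0 : ℝ) 1 := self_mem_nhdsWithin
  replace hT : Tendsto T (𝓝[Set.Icc 0 1] t₀) (𝓝 (T t₀)) := hT
  replace hV : Tendsto V (𝓝[Set.Icc 0 1] t₀) (𝓝 (V t₀)) := hV
  replace hX : Tendsto X (𝓝[Set.Icc 0 1] t₀) (𝓝 (X t₀)) := hX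
  replace hY : Tendsto Y (𝓝[Set.Icc 0 1] t₀) (𝓝 (Y t₀)) := hY
  have hζ' : (star ζ).im ≠ 0 := by simpa using hζ
  have hR : ∀ {z : ℂ}, z.im ≠ 0 → (fun t => resolv (addBdd (𝒜 t) (V t)) z)
      =O[𝓝[Set.Icc 0 1] t₀] fun _ => (1 : ℝ) := by
    intro z hz
    refine Asymptotics.IsBigO.of_bound (|z.im|⁻¹) ?_
    filter_upwards [hmem] with t ht
    rw [norm_one, mul_one]
    exact norm_resolv_le (hfam.isSelfAdjoint ht) hz
  -- `resolvD_eq` carries the bound from `𝒜 t` at `i` to `𝒜 t + V t` at `ζ̄`; the resolvents in `H`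
  -- that it involves are bounded uniformly in `t` because `ζ` is not real.
  have hRD : (fun t => resolvD j (addBdd (𝒜 t) (V t)) (star ζ))
      =O[𝓝[Set.Icc 0 1] t₀] fun _ => (1 : ℝ) := by
    have h1 : (fun t => (star ζ - Complex.I) • (1 : H →L[ℂ] H) - V t)
        =O[𝓝[Set.Icc 0 1] t₀] fun _ => (1 : ℝ) := (hV.const_sub _).isBigO_one ℝ
    have h2 : (fun _ : ℝ => (1 : H →L[ℂ] H)) =O[𝓝[Set.Icc 0 1] t₀] fun _ => (1 : ℝ) :=
      Asymptotics.isBigO_const_const _ one_ne_zero _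
    refine (isBigO_comp hb (h2.add (isBigO_comp h1 (hR hζ')))).congr' ?_ .rfl
    filter_upwards [hmem] with t ht
    exact (hfam.resolvD_eq ht (mem_resolvSet_of_im_ne_zero (hfam.isSelfAdjoint ht) hζ')).symm
  have hM := isBigO_adjoint (isBigO_comp (hT.isBigO_one ℝ) hRD)
  have hW := tendsto_opW hX hY (isUnit_gram (hker.comm t₀ ht₀) (hker.invertible t₀ ht₀))
  have hE : Tendsto (fun t => X t ∘L (Y t₀)† - Y t ∘L (X t₀)†) (𝓝[Set.Icc 0 1] t₀) (𝓝 0) := by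
    have h1 := (tendsto_comp hX (tendsto_const_nhds (x := (Y t₀)†))).sub
      (tendsto_comp hY (tendsto_const_nhds (x := (X t₀)†)))
    rwa [hker.comm t₀ ht₀, sub_self] at h1
  have hZ : Tendsto (fun t => opZ (X t) (Y t) (X t₀) (Y t₀)) (𝓝[Set.Icc 0 1] t₀) (𝓝 0) := by
    have h1 := tendsto_comp (tendsto_adjoint hW)
      (tendsto_comp hE (tendsto_const_nhds (x := opW (X t₀) (Y t₀))))
    rwa [ContinuousLinearMap.zero_comp, ContinuousLinearMap.comp_zero] at h1
  have hT0 : Tendsto (fun t => T t - T t₀) (𝓝[Set.Icc 0 1] t₀) (𝓝 0) := by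
    simpa using hT.sub_const (T t₀)
  have hV0 : Tendsto (fun t => V t₀ - V t) (𝓝[Set.Icc 0 1] t₀) (𝓝 0) := by
    simpa using hV.const_sub (V t₀)
  have h1 := tendsto_zero_comp (hR hζ)
    (tendsto_zero_comp_const (resolv (addBdd (𝒜 t₀) (V t₀)) ζ) hV0)
  have h2 := tendsto_zero_comp hM
    (tendsto_zero_comp_const (T t₀ ∘L resolvD j (addBdd (𝒜 t₀) (V t₀)) ζ) hZ)
  have h3 := tendsto_zero_comp hM (tendsto_zero_comp
    (Asymptotics.isBigO_const_const (opJ K) (one_ne_zero (α := ℝ)) _)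
    (tendsto_zero_comp_const (resolvD j (addBdd (𝒜 t₀) (V t₀)) ζ) hT0))
  rw [tendsto_iff_norm_sub_tendsto_zero, ← tendsto_zero_iff_norm_tendsto_zero]
  have h4 := (h1.add h2).add h3
  rw [add_zero, add_zero] at h4
  refine h4.congr' ?_
  filter_upwards [hmem] with t ht
  exact (hfam.krein hker ht ht₀ (mem_resolvSet_of_im_ne_zero (hfam.isSelfAdjoint ht) hζ)
    (mem_resolvSet_of_im_ne_zero (hfam.isSelfAdjoint ht₀) hζ)).symm

theorem IsFamily.eventually_mem_resolvSet_and_tendsto (hfam : IsFamily j T Q 𝒜 V)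
    (hker : IsKernelFamily Q X Y) {t₀ : ℝ} (ht₀ : t₀ ∈ Set.Icc (0 : ℝ) 1)
    (hb : ResolventBounded j 𝒜 t₀) (hT : Continuous01 T t₀) (hV : Continuous01 V t₀)
    (hX : Continuous01 X t₀) (hY : Continuous01 Y t₀) {ζ : ℂ}
    (hζ : ζ ∈ resolvSet (addBdd (𝒜 t₀) (V t₀))) :
    (∀ᶠ p in 𝓝[Set.Icc 0 1] t₀ ×ˢ 𝓝 ζ, p.2 ∈ resolvSet (addBdd (𝒜 p.1) (V p.1))) ∧
    (∀ᶠ t in 𝓝[Set.Icc 0 1] t₀, ζ ∈ resolvSet (addBdd (𝒜 t) (V t))) ∧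
      Tendsto (fun t => resolv (addBdd (𝒜 t) (V t)) ζ) (𝓝[Set.Icc 0 1] t₀)
        (𝓝 (resolv (addBdd (𝒜 t₀) (V t₀)) ζ)) := by
  have hI : Complex.I.im ≠ 0 := by simp
  have h1 : ∀ᶠ t in 𝓝[Set.Icc 0 1] t₀, Complex.I ∈ resolvSet (addBdd (𝒜 t) (V t)) := by
    filter_upwards [self_mem_nhdsWithin] with t ht
    exact mem_resolvSet_of_im_ne_zero (hfam.isSelfAdjoint ht) hI
  have h2 := mem_resolvSet_of_im_ne_zero (hfam.isSelfAdjoint ht₀) hI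
  have h3 := hfam.tendsto_resolv_of_im_ne_zero hker ht₀ hb hT hV hX hY hI
  exact ⟨eventually_mem_resolvSet_prod h1 h2 h3 hζ, tendsto_resolv h1 h2 h3 hζ⟩

theorem IsFamily.hasDeriv01_resolv (hfam : IsFamily j T Q 𝒜 V)
    (hker : IsKernelFamily Q X Y) {t₀ : ℝ} (ht₀ : t₀ ∈ Set.Icc (0 : ℝ) 1)
    (hc : ResolventContinuous j 𝒜 t₀) {T' : D →L[ℂ] Pair K} {V' : H →L[ℂ] H} {X' Y' : K →L[ℂ] K}
    (hT : HasDeriv01 T T' t₀) (hV : HasDeriv01 V V' t₀) (hX : HasDeriv01 X X' t₀)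
    (hY : HasDeriv01 Y Y' t₀) {ζ : ℂ} (hζ : ζ ∈ resolvSet (addBdd (𝒜 t₀) (V t₀))) :
    HasDeriv01 (fun t => resolv (addBdd (𝒜 t) (V t)) ζ)
      (-(resolv (addBdd (𝒜 t₀) (V t₀)) ζ ∘L V' ∘L resolv (addBdd (𝒜 t₀) (V t₀)) ζ)
        + (T t₀ ∘L resolvD j (addBdd (𝒜 t₀) (V t₀)) (star ζ))† ∘L (opW (X t₀) (Y t₀))† ∘L
            (X' ∘L (Y t₀)† - Y' ∘L (X t₀)†) ∘L opW (X t₀) (Y t₀) ∘L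
            T t₀ ∘L resolvD j (addBdd (𝒜 t₀) (V t₀)) ζ
        + (T t₀ ∘L resolvD j (addBdd (𝒜 t₀) (V t₀)) (star ζ))† ∘L opJ K ∘L
            T' ∘L resolvD j (addBdd (𝒜 t₀) (V t₀)) ζ) t₀ := by
  have hTc : Tendsto T (𝓝[Set.Icc 0 1] t₀) (𝓝 (T t₀)) := hT.continuousWithinAt
  have hVc : Tendsto V (𝓝[Set.Icc 0 1] t₀) (𝓝 (V t₀)) := hV.continuousWithinAt
  have hXc : Tendsto X (𝓝[Set.Icc 0 1] t₀) (𝓝 (X t₀)) := hX.continuousWithinAt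
  have hYc : Tendsto Y (𝓝[Set.Icc 0 1] t₀) (𝓝 (Y t₀)) := hY.continuousWithinAt
  have hb : ResolventBounded j 𝒜 t₀ := hc.tendsto.isBigO_one ℝ
  have hζ' := star_mem_resolvSet (hfam.isSelfAdjoint ht₀) hζ
  obtain ⟨-, hev, hlim⟩ := hfam.eventually_mem_resolvSet_and_tendsto hker ht₀ hb hTc hVc hXc hYc hζ
  obtain ⟨-, hev', hlim'⟩ :=
    hfam.eventually_mem_resolvSet_and_tendsto hker ht₀ hb hTc hVc hXc hYc hζ'
  -- Convergence into `D`, not mere boundedness, is needed here: this factor multiplies difference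
  -- quotients with nonzero limits.
  have hRD : Tendsto (fun t => resolvD j (addBdd (𝒜 t) (V t)) (star ζ)) (𝓝[Set.Icc 0 1] t₀)
      (𝓝 (resolvD j (addBdd (𝒜 t₀) (V t₀)) (star ζ))) := by
    rw [hfam.resolvD_eq ht₀ hζ']
    refine (tendsto_comp hc.tendsto
      ((tendsto_comp (hVc.const_sub _) hlim').const_add 1)).congr' ?_
    filter_upwards [self_mem_nhdsWithin, hev'] with t ht htζ using (hfam.resolvD_eq ht htζ).symm
  have hM := tendsto_adjoint (tendsto_comp hTc hRD)
  have hW := tendsto_adjoint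
    (tendsto_opW hXc hYc (isUnit_gram (hker.comm t₀ ht₀) (hker.invertible t₀ ht₀)))
  have hE : HasDerivWithinAt (fun t => X t ∘L (Y t₀)† - Y t ∘L (X t₀)†)
      (X' ∘L (Y t₀)† - Y' ∘L (X t₀)†) (Set.Icc 0 1) t₀ :=
    (hasDerivWithinAt_comp_const hX _).sub (hasDerivWithinAt_comp_const hY _)
  have h1 := hasDerivWithinAt_comp_of_eq_zero hlim
    (hasDerivWithinAt_comp_const (hV.const_sub (V t₀)) (resolv (addBdd (𝒜 t₀) (V t₀)) ζ))
    (by rw [sub_self, ContinuousLinearMap.zero_comp])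
  have h2 := hasDerivWithinAt_comp_of_eq_zero (tendsto_comp hM hW)
    (hasDerivWithinAt_comp_const hE
      (opW (X t₀) (Y t₀) ∘L T t₀ ∘L resolvD j (addBdd (𝒜 t₀) (V t₀)) ζ))
    (by rw [hker.comm t₀ ht₀, sub_self, ContinuousLinearMap.zero_comp])
  have h3 := hasDerivWithinAt_comp_of_eq_zero hM
    (hasDerivWithinAt_const_comp (opJ K) (hasDerivWithinAt_comp_const (hT.sub_const (T t₀))
      (resolvD j (addBdd (𝒜 t₀) (V t₀)) ζ)))
    (by rw [sub_self, ContinuousLinearMap.zero_comp, ContinuousLinearMap.comp_zero])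
  have h4 := ((h1.add h2).add h3).const_add (resolv (addBdd (𝒜 t₀) (V t₀)) ζ)
  rw [ContinuousLinearMap.neg_comp, ContinuousLinearMap.comp_neg] at h4
  refine h4.congr_of_eventuallyEq ?_ ?_
  · filter_upwards [self_mem_nhdsWithin, hev] with t ht htζ
    exact sub_eq_iff_eq_add'.mp (hfam.krein hker ht ht₀ htζ hζ)
  · exact sub_eq_iff_eq_add'.mp (hfam.krein hker ht₀ ht₀ hζ hζ)

end Continuity

/-! ### From the eigenvalues of the resolvent back to those of the operator -/

section Labels

variable {H : Type*} [NormedAddCommGroup H] [InnerProductSpace ℂ H]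

theorem mem_spec_of_finrank_pos {B : H →ₗ.[ℂ] H} {ζ : ℂ}
    (h : 0 < Module.finrank ℂ (eigSpace B ζ)) : ζ ∈ spec B := by
  by_contra hζ
  rw [eigSpace_eq_bot (notMem_spec.mp hζ), finrank_bot] at h
  exact h.false

/-- Write `κ = lam₀ - c`. If `z` is closer to `κ⁻¹` than `|κ⁻¹| / 2`, then `|z|` exceeds that half,
so `|z⁻¹ - κ| = |κ⁻¹ - z| |κ| / |z| ≤ |κ| ≤ r`. Hence `c + z⁻¹` stays in the disc in which `lam₀` is
alone. -/
theorem isolated_in_spectrum_resolv {B : H →ₗ.[ℂ] H} {c lam₀ r : ℝ}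
    (hc : (c : ℂ) ∈ resolvSet B) (hne : lam₀ ≠ c) (hr : |lam₀ - c| ≤ r)
    (hiso : Metric.closedBall (lam₀ : ℂ) r ∩ spec B = {(lam₀ : ℂ)}) {z : ℝ}
    (hz : z ∈ spectrum ℝ (resolv B (c : ℂ))) (hzc : |z - (lam₀ - c)⁻¹| < |(lam₀ - c)⁻¹| / 2) :
    z = (lam₀ - c)⁻¹ := by
  have hκ : lam₀ - c ≠ 0 := sub_ne_zero.mpr hne
  set κ := lam₀ - c with hκ_def
  have hκ' : 0 < |κ⁻¹| := abs_pos.mpr (inv_ne_zero hκ)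
  have hz1 : |κ⁻¹| / 2 < |z| := by
    have h1 := abs_sub_abs_le_abs_sub κ⁻¹ z
    rw [abs_sub_comm] at h1
    linarith
  have hz0 : z ≠ 0 := abs_pos.mp (by linarith)
  have h1 := (mem_spec_iff_mem_spectrum hc hz0).mpr hz
  have h2 : |z⁻¹ - κ| ≤ |κ| := by
    have h3 : z⁻¹ - κ = (κ⁻¹ - z) * κ * z⁻¹ := by field_simp
    rw [h3, abs_mul, abs_mul, abs_inv, abs_sub_comm]
    have h4 : |z - κ⁻¹| ≤ |z| := by linarith
    calc |z - κ⁻¹| * |κ| * |z|⁻¹ ≤ |z| * |κ| * |z|⁻¹ := by gcongr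
      _ = |κ| := by have := abs_ne_zero.mpr hz0; field_simp
  have h3 : ((c + z⁻¹ : ℝ) : ℂ) ∈ Metric.closedBall (lam₀ : ℂ) r ∩ spec B := by
    refine ⟨?_, h1⟩
    rw [Metric.mem_closedBall, dist_eq_norm, ← Complex.ofReal_sub, Complex.norm_real,
      Real.norm_eq_abs]
    have h4 : c + z⁻¹ - lam₀ = z⁻¹ - κ := by rw [hκ_def]; ring
    rw [h4]
    exact h2.trans hr
  rw [hiso, Set.mem_singleton_iff] at h3
  have h4 : c + z⁻¹ = lam₀ := by exact_mod_cast h3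
  rw [hκ_def, ← h4, add_sub_cancel_left, inv_inv]

variable [CompleteSpace H]

/-- The eigenvalues of `B t` near `lam₀` are `c + (γ k t)⁻¹`, if the `γ k t` are those of
`(B t - c)⁻¹` near `(lam₀ - c)⁻¹`. -/
theorem labelsEigenvalues_of_resolv {B : ℝ → H →ₗ.[ℂ] H} {t₀ : ℝ}
    (hsa : ∀ t ∈ Set.Icc (0 : ℝ) 1, IsSelfAdjoint (B t))
    (hres : ∀ ζ ∈ resolvSet (B t₀),
      ∀ᶠ p in 𝓝[Set.Icc 0 1] t₀ ×ˢ 𝓝 ζ, p.2 ∈ resolvSet (B p.1))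
    {c lam₀ : ℝ} (hc : (c : ℂ) ∈ resolvSet (B t₀)) (hne : lam₀ ≠ c) {m : ℕ}
    {γ : Fin m → ℝ → ℝ} (hγ₀ : ∀ k, γ k t₀ = (lam₀ - c)⁻¹)
    (hγ : ∀ k, ContinuousWithinAt (γ k) (Set.Icc 0 1) t₀) {δ : ℝ} (hδ : 0 < δ)
    (hev : ∀ᶠ t in 𝓝[Set.Icc 0 1] t₀, ∀ z : ℝ, |z - (lam₀ - c)⁻¹| < δ →
      Module.finrank ℂ (Module.End.eigenspace (resolv (B t) (c : ℂ) : H →ₗ[ℂ] H) (z : ℂ)) =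
          Nat.card {k // γ k t = z} ∧
        (z ∈ spectrum ℝ (resolv (B t) (c : ℂ)) → ∃ k, γ k t = z)) :
    LabelsEigenvalues B t₀ lam₀ (fun k t => c + (γ k t)⁻¹) := by
  have hκ : lam₀ - c ≠ 0 := sub_ne_zero.mpr hne
  refine ⟨fun k => by simp only [hγ₀, inv_inv, add_sub_cancel], fun r hr hiso => ?_⟩
  -- a small disc in which the resolvent may be used
  have hinv : ∀ᶠ μ in 𝓝 lam₀, |(μ - c)⁻¹ - (lam₀ - c)⁻¹| < δ := by
    have h1 : Tendsto (fun μ : ℝ => (μ - c)⁻¹) (𝓝 lam₀) (𝓝 (lam₀ - c)⁻¹) :=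
      ((continuous_id.sub continuous_const).tendsto lam₀).inv₀ hκ
    have h2 := h1.eventually (Metric.ball_mem_nhds _ hδ)
    exact h2
  obtain ⟨ρ, hρ, hρball⟩ := Metric.eventually_nhds_iff.mp (hinv.and (eventually_ne_nhds hne))
  have hcompact : IsCompact (Metric.closedBall (lam₀ : ℂ) r \ Metric.ball (lam₀ : ℂ) ρ) :=
    (isCompact_closedBall _ _).diff Metric.isOpen_ball
  -- The given disc may be too large for the information on the resolvent. Compactness of the
  -- annulus between it and the small disc keeps that annulus free of spectrum for `t` near `t₀`.
  have hann : ∀ᶠ t in 𝓝[Set.Icc 0 1] t₀,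
      ∀ ζ ∈ Metric.closedBall (lam₀ : ℂ) r \ Metric.ball (lam₀ : ℂ) ρ, ζ ∈ resolvSet (B t) := by
    have h1 : ∀ᶠ p in 𝓝[Set.Icc 0 1] t₀ ×ˢ
        𝓝ˢ (Metric.closedBall (lam₀ : ℂ) r \ Metric.ball (lam₀ : ℂ) ρ),
        p.2 ∈ resolvSet (B p.1) := by
      refine hcompact.mem_prod_nhdsSet_of_forall fun ζ hζ => hres ζ ?_
      by_contra hζs
      have h2 : ζ ∈ Metric.closedBall (lam₀ : ℂ) r ∩ spec (B t₀) := ⟨hζ.1, hζs⟩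
      rw [hiso, Set.mem_singleton_iff] at h2
      exact hζ.2 (h2 ▸ Metric.mem_ball_self hρ)
    exact h1.curry.mono fun t ht ζ hζ => ht.self_of_nhdsSet ζ hζ
  have hclose : ∀ᶠ t in 𝓝[Set.Icc 0 1] t₀, ∀ k, |c + (γ k t)⁻¹ - lam₀| < min ρ r := by
    rw [eventually_all]
    intro k
    have h1 : Tendsto (fun t => c + (γ k t)⁻¹) (𝓝[Set.Icc 0 1] t₀) (𝓝 lam₀) := by
      have h2 := ((hγ k).tendsto.inv₀ (by rw [hγ₀]; exact inv_ne_zero hκ)).const_add c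
      rwa [hγ₀, inv_inv, add_sub_cancel] at h2
    exact h1.eventually (Metric.ball_mem_nhds _ (lt_min hρ hr))
  have hct : ∀ᶠ t in 𝓝[Set.Icc 0 1] t₀, (c : ℂ) ∈ resolvSet (B t) :=
    (hres c hc).curry.mono fun t ht => ht.self_of_nhds
  filter_upwards [self_mem_nhdsWithin, hev, hann, hclose, hct] with t ht hevt hannt hcloset hctt
  have hdist : ∀ a b : ℝ, dist (a : ℂ) (b : ℂ) = |a - b| := fun a b => by
    rw [dist_eq_norm, ← Complex.ofReal_sub, Complex.norm_real, Real.norm_eq_abs]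
  have hlam_iff : ∀ μ : ℝ, ∀ k, c + (γ k t)⁻¹ = μ ↔ γ k t = (μ - c)⁻¹ := fun μ k => by
    rw [← eq_sub_iff_add_eq', inv_eq_iff_eq_inv]
  have hcard : ∀ μ ∈ Metric.ball (lam₀ : ℂ) r, Module.finrank ℂ (eigSpace (B t) μ) =
      Nat.card {k : Fin m // ((c + (γ k t)⁻¹ : ℝ) : ℂ) = μ} := by
    intro μ hμ
    -- In the first case both counts are zero; otherwise `μ` is real and lies in the small disc,
    -- where the multiplicities of the resolvent apply.
    by_cases hμr : μ ∈ resolvSet (B t) ∧ (μ.im ≠ 0 ∨ μ ∉ Metric.ball (lam₀ : ℂ) ρ)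
    · rw [eigSpace_eq_bot hμr.1, finrank_bot]
      symm
      rw [Nat.card_eq_zero]
      refine Or.inl ⟨fun ⟨k, hk⟩ => ?_⟩
      rcases hμr.2 with h | h
      · rw [← hk] at h
        exact h (Complex.ofReal_im _)
      · rw [← hk, Metric.mem_ball, hdist] at h
        exact h ((hcloset k).trans_le (min_le_left _ _))
    · have him : μ.im = 0 := by
        by_contra h
        exact hμr ⟨mem_resolvSet_of_im_ne_zero (hsa t ht) h, Or.inl h⟩
      have hμρ : μ ∈ Metric.ball (lam₀ : ℂ) ρ := by
        by_contra h
        exact hμr ⟨hannt μ ⟨Metric.ball_subset_closedBall hμ, h⟩, Or.inr h⟩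
      obtain ⟨x, rfl⟩ : ∃ x : ℝ, (x : ℂ) = μ := ⟨μ.re, Complex.ext rfl (by simp [him])⟩
      rw [Metric.mem_ball, hdist] at hμρ
      obtain ⟨h1, h2⟩ := hρball hμρ
      have h3 : ((x : ℂ) - c)⁻¹ = (((x - c)⁻¹ : ℝ) : ℂ) := by push_cast; rfl
      rw [eigSpace_eq_eigenspace hctt (by exact_mod_cast h2), h3, (hevt _ h1).1]
      refine Nat.card_congr (Equiv.subtypeEquivRight fun k => ?_)
      rw [← hlam_iff]
      norm_cast
  refine ⟨Set.Subset.antisymm ?_ ?_, hcard⟩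
  · rintro μ ⟨hμs, hμ⟩
    have him : μ.im = 0 := by
      by_contra h
      exact hμs (mem_resolvSet_of_im_ne_zero (hsa t ht) h)
    have hμρ : μ ∈ Metric.ball (lam₀ : ℂ) ρ := by
      by_contra h
      exact hμs (hannt μ ⟨Metric.ball_subset_closedBall hμ, h⟩)
    obtain ⟨x, rfl⟩ : ∃ x : ℝ, (x : ℂ) = μ := ⟨μ.re, Complex.ext rfl (by simp [him])⟩
    rw [Metric.mem_ball, hdist] at hμρ
    obtain ⟨h1, h2⟩ := hρball hμρ
    have h3 : (x - c)⁻¹ ∈ spectrum ℝ (resolv (B t) (c : ℂ)) := by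
      rw [← mem_spec_iff_mem_spectrum hctt (inv_ne_zero (sub_ne_zero.mpr h2)), inv_inv,
        add_sub_cancel]
      exact hμs
    obtain ⟨k, hk⟩ := (hevt _ h1).2 h3
    exact ⟨k, congrArg Complex.ofReal ((hlam_iff x k).mpr hk)⟩
  · rintro _ ⟨k, rfl⟩
    have hk : ((c + (γ k t)⁻¹ : ℝ) : ℂ) ∈ Metric.ball (lam₀ : ℂ) r := by
      rw [Metric.mem_ball, hdist]
      exact (hcloset k).trans_le (min_le_right _ _)
    refine ⟨mem_spec_of_finrank_pos ?_, hk⟩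
    rw [hcard _ hk]
    have : Nonempty {i : Fin m // ((c + (γ i t)⁻¹ : ℝ) : ℂ) = ((c + (γ k t)⁻¹ : ℝ) : ℂ)} :=
      ⟨⟨k, rfl⟩⟩
    exact Nat.card_pos

end Labels

/-! ### Hadamard's formula -/

section Hadamard

variable {H K D : Type*}
  [NormedAddCommGroup H] [InnerProductSpace ℂ H] [CompleteSpace H]
  [NormedAddCommGroup K] [InnerProductSpace ℂ K] [CompleteSpace K]
  [NormedAddCommGroup D] [NormedSpace ℂ D]
  {A : H →ₗ.[ℂ] H} {j : D →L[ℂ] HPlus A}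
  {T : ℝ → D →L[ℂ] Pair K} {Q : ℝ → Pair K →L[ℂ] Pair K} {𝒜 : ℝ → H →ₗ.[ℂ] H}
  {V : ℝ → H →L[ℂ] H} {X Y : ℝ → K →L[ℂ] K}

/-- The derivative of the identity `X_t Y_t* = Y_t X_t*`. -/
theorem IsKernelFamily.deriv_comm (hker : IsKernelFamily Q X Y) {t₀ : ℝ}
    (ht₀ : t₀ ∈ Set.Icc (0 : ℝ) 1) {X' Y' : K →L[ℂ] K} (hX : HasDeriv01 X X' t₀)
    (hY : HasDeriv01 Y Y' t₀) :
    X t₀ ∘L Y'† - Y t₀ ∘L X'† = -(X' ∘L (Y t₀)† - Y' ∘L (X t₀)†) := by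
  have hprod : ∀ {F G : ℝ → K →L[ℂ] K} {F' G' : K →L[ℂ] K}, HasDeriv01 F F' t₀ →
      HasDeriv01 G G' t₀ → HasDerivWithinAt (fun t => F t ∘L (G t)†)
        (F t₀ ∘L G'† + F' ∘L (G t₀)†) (Set.Icc 0 1) t₀ := by
    intro F G F' G' hF hG
    have h1 := hasDerivWithinAt_comp_of_eq_zero (g := fun t => (G t)† - (G t₀)†)
      hF.continuousWithinAt ((hasDerivWithinAt_adjoint hG).sub_const _) (sub_self _)
    have h2 := h1.add (hasDerivWithinAt_comp_const hF ((G t₀)†))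
    refine h2.congr (fun t _ => ?_) ?_ <;>
    · rw [Pi.add_apply, ContinuousLinearMap.comp_sub, sub_add_cancel]
  have h1 := hprod hX hY
  have h2 := (hprod hY hX).congr hker.comm (hker.comm t₀ ht₀)
  -- Derivatives within `[0, 1]` are unique at the endpoints as well.
  have h3 := (uniqueDiffOn_Icc (zero_lt_one' ℝ) t₀ ht₀).eq_deriv _ h1 h2
  rw [neg_sub, sub_eq_sub_iff_add_eq_add, h3, add_comm]

/-- The derivative of the Green identity. -/
theorem IsFamily.deriv_omega (hfam : IsFamily j T Q 𝒜 V) {t₀ : ℝ}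
    (ht₀ : t₀ ∈ Set.Icc (0 : ℝ) 1) {T' : D →L[ℂ] Pair K} (hT : HasDeriv01 T T' t₀) (u : D) :
    omega (T t₀ u) (T' u) = -omega (T' u) (T t₀ u) := by
  have h0 : HasDerivWithinAt (fun t => T t u) (T' u) (Set.Icc 0 1) t₀ := by
    rw [HasDeriv01, hasDerivWithinAt_iff_tendsto_slope] at hT
    rw [hasDerivWithinAt_iff_tendsto_slope]
    refine (((ContinuousLinearMap.apply ℂ (Pair K) u).continuous.tendsto _).comp hT).congr
      fun t => ?_
    simp [slope_def_module]
  have h1 : HasDerivWithinAt (fun t => (inner ℂ (T t u) (opJ K (T t u)) : ℂ))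
      (inner ℂ (T t₀ u) (opJ K (T' u)) + inner ℂ (T' u) (opJ K (T t₀ u))) (Set.Icc 0 1) t₀ :=
    h0.inner ℂ (((opJ K).restrictScalars ℝ).hasFDerivAt.comp_hasDerivWithinAt t₀ h0)
  have hconst : ∀ t ∈ Set.Icc (0 : ℝ) 1, (inner ℂ (T t u) (opJ K (T t u)) : ℂ) =
      inner ℂ (emb j u) (adjPlus A (j u)) - inner ℂ (adjPlus A (j u)) (emb j u) := fun t ht => by
    rw [inner_opJ, ← (hfam.traceOp t ht).green u u]
  have h2 := (hasDerivWithinAt_const t₀ (Set.Icc (0 : ℝ) 1)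
    (inner ℂ (emb j u) (adjPlus A (j u)) - inner ℂ (adjPlus A (j u)) (emb j u) : ℂ)).congr hconst
    (hconst t₀ ht₀)
  have h3 := (uniqueDiffOn_Icc (zero_lt_one' ℝ) t₀ ht₀).eq_deriv _ h1 h2
  rw [inner_opJ, inner_opJ, add_comm] at h3
  exact eq_neg_of_add_eq_zero_left h3

theorem isSelfAdjoint_of_hasDeriv01 {G : ℝ → H →L[ℂ] H} {G' : H →L[ℂ] H} {t₀ : ℝ}
    (ht₀ : t₀ ∈ Set.Icc (0 : ℝ) 1) (hG : HasDeriv01 G G' t₀)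
    (hsa : ∀ᶠ t in 𝓝[Set.Icc 0 1] t₀, IsSelfAdjoint (G t)) : IsSelfAdjoint G' := by
  have h1 := (hasDerivWithinAt_adjoint hG).congr_of_eventuallyEq
    (hsa.mono fun t ht => (show (G t)† = G t from ht).symm)
    (show (G t₀)† = G t₀ from hsa.self_of_nhdsWithin ht₀).symm
  exact (uniqueDiffOn_Icc (zero_lt_one' ℝ) t₀ ht₀).eq_deriv _ h1 hG

variable [CompleteSpace D]

theorem IsFamily.hadamard (hfam : IsFamily j T Q 𝒜 V)
    (hker : IsKernelFamily Q X Y) {t₀ : ℝ} (ht₀ : t₀ ∈ Set.Icc (0 : ℝ) 1)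
    (hrc : ResolventContinuous j 𝒜 t₀) {T' : D →L[ℂ] Pair K} {V' : H →L[ℂ] H} {X' Y' : K →L[ℂ] K}
    (hT : HasDeriv01 T T' t₀) (hV : HasDeriv01 V V' t₀) (hX : HasDeriv01 X X' t₀)
    (hY : HasDeriv01 Y Y' t₀) {lam₀ : ℝ} {m : ℕ} (hm1 : 1 ≤ m)
    (hm : Module.finrank ℂ (eigSpace (addBdd (𝒜 t₀) (V t₀)) (lam₀ : ℂ)) = m)
    (hiso : ∃ r : ℝ, 0 < r ∧
      Metric.closedBall (lam₀ : ℂ) r ∩ spec (addBdd (𝒜 t₀) (V t₀)) = {(lam₀ : ℂ)}) :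
    ∃ (u : Fin m → D) (lam : Fin m → ℝ → ℝ),
      Orthonormal ℂ (fun k => emb j (u k)) ∧
      (∀ k, emb j (u k) ∈ eigSpace (addBdd (𝒜 t₀) (V t₀)) (lam₀ : ℂ)) ∧
      LabelsEigenvalues (fun t => addBdd (𝒜 t) (V t)) t₀ lam₀ lam ∧
      ∀ k, ∃ φ : K,
        φ = opW (X t₀) (Y t₀) (T t₀ (u k)) ∧
        (∀ ψ : K, ((T t₀ (u k)).fst = -((Y t₀)†) ψ ∧ (T t₀ (u k)).snd = ((X t₀)†) ψ) ↔ ψ = φ) ∧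
        HasDeriv01 (fun t => (lam k t : ℂ))
          (inner ℂ (emb j (u k)) (V' (emb j (u k)))
            + inner ℂ φ ((X t₀ ∘L Y'† - Y t₀ ∘L X'†) φ)
            + omega (T t₀ (u k)) (T' (u k))) t₀ := by
  obtain ⟨r, hr, hiso⟩ := hiso
  have hb : ResolventBounded j 𝒜 t₀ := hrc.tendsto.isBigO_one ℝ
  have hcont := fun ζ (hζ : ζ ∈ resolvSet (addBdd (𝒜 t₀) (V t₀))) =>
    hfam.eventually_mem_resolvSet_and_tendsto hker ht₀ hb hT.continuousWithinAt
      hV.continuousWithinAt hX.continuousWithinAt hY.continuousWithinAt hζ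
  -- a real point of the resolvent set
  obtain ⟨c, hne, hcr, hc⟩ : ∃ c : ℝ, lam₀ ≠ c ∧ |lam₀ - c| ≤ r ∧
      (c : ℂ) ∈ resolvSet (addBdd (𝒜 t₀) (V t₀)) := by
    -- A point on the boundary of the disc: it still belongs to the closed disc, whose only spectral
    -- point is `lam₀`.
    refine ⟨lam₀ + r, by linarith, by simp [abs_of_pos hr], ?_⟩
    by_contra h
    have h1 : ((lam₀ + r : ℝ) : ℂ) ∈
        Metric.closedBall (lam₀ : ℂ) r ∩ spec (addBdd (𝒜 t₀) (V t₀)) :=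
      ⟨by simp [abs_of_pos hr], h⟩
    rw [hiso, Set.mem_singleton_iff] at h1
    have h2 : lam₀ + r = lam₀ := by exact_mod_cast h1
    linarith
  have hκ : lam₀ - c ≠ 0 := sub_ne_zero.mpr hne
  obtain ⟨-, hcev, -⟩ := hcont c hc
  have hG := hfam.hasDeriv01_resolv hker ht₀ hrc hT hV hX hY hc
  have hsaG : ∀ᶠ t in 𝓝[Set.Icc 0 1] t₀, IsSelfAdjoint (resolv (addBdd (𝒜 t) (V t)) (c : ℂ)) := by
    filter_upwards [self_mem_nhdsWithin, hcev] with t ht htc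
    exact isSelfAdjoint_resolv (hfam.isSelfAdjoint ht) htc
  have heig : eigSpace (addBdd (𝒜 t₀) (V t₀)) (lam₀ : ℂ) = Module.End.eigenspace
      (resolv (addBdd (𝒜 t₀) (V t₀)) (c : ℂ) : H →ₗ[ℂ] H) (((lam₀ - c)⁻¹ : ℝ) : ℂ) := by
    rw [eigSpace_eq_eigenspace hc (by exact_mod_cast hne)]
    push_cast
    rfl
  obtain ⟨x, d, γ, hx, hGx, hdx, hγ₀, hγd, δ, hδ, hev⟩ :=
    exists_differentiable_eigenvalues ht₀ hsaG (isSelfAdjoint_of_hasDeriv01 ht₀ hG hsaG) hG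
      (half_pos (abs_pos.mpr (inv_ne_zero hκ)))
      (fun z hz hzc => isolated_in_spectrum_resolv hc hne hcr hiso hz hzc) hm1 (heig ▸ hm)
  have hxe : ∀ k, x k ∈ eigSpace (addBdd (𝒜 t₀) (V t₀)) (lam₀ : ℂ) := fun k => by
    rw [heig, Module.End.mem_eigenspace_iff]
    exact hGx k
  have hxd : ∀ k, ∃ d : D, emb j d = x k := fun k => hfam.domain_sub t₀ ht₀ _ (hxe k).1
  choose u hu using hxd
  refine ⟨u, fun k t => c + (γ k t)⁻¹, by simpa only [hu] using hx,
    fun k => by rw [hu]; exact hxe k,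
    labelsEigenvalues_of_resolv (fun t ht => hfam.isSelfAdjoint ht)
      (fun ζ hζ => (hcont ζ hζ).1) hc hne hγ₀ (fun k => (hγd k).continuousWithinAt) hδ hev,
    fun k => ⟨_, rfl, fun ψ => ⟨fun h => ?_, fun h => ?_⟩, ?_⟩⟩
  · exact (opW_eq_of_eq (hker.comm t₀ ht₀) (hker.invertible t₀ ht₀) h.1 h.2).symm
  · rw [h]
    exact eq_of_mem_ker_row (hker.comm t₀ ht₀) (hker.invertible t₀ ht₀)
      (hfam.row_trace_eq_zero hker ht₀ (by rw [hu]; exact (hxe k).1))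
  · set g : ℂ := (((lam₀ - c)⁻¹ : ℝ) : ℂ) with hg
    have hgne : g ≠ 0 := by rw [hg]; exact_mod_cast inv_ne_zero hκ
    have hgstar : (starRingEnd ℂ) g = g := Complex.conj_ofReal _
    have hRD : resolvD j (addBdd (𝒜 t₀) (V t₀)) (c : ℂ) (x k) = g • u k := by
      refine emb_injective hfam.traceDomain.injective ?_
      rw [hfam.emb_resolvD ht₀ hc, map_smul, hu]
      exact hGx k
    have hstar : star (c : ℂ) = c := Complex.conj_ofReal c
    have hsymR : ∀ y : H, inner ℂ (x k) (resolv (addBdd (𝒜 t₀) (V t₀)) (c : ℂ) y) =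
        g * inner ℂ (x k) y := fun y => by
      have h1 := ContinuousLinearMap.isSelfAdjoint_iff_isSymmetric.mp
        (hsaG.self_of_nhdsWithin ht₀) (x k) y
      simp only [ContinuousLinearMap.coe_coe] at h1
      rw [← h1, hGx, inner_smul_left, hgstar]
    have hdk := hdx k
    rw [hstar] at hdk
    simp only [add_apply, neg_apply, ContinuousLinearMap.comp_apply, inner_add_right,
      inner_neg_right, ContinuousLinearMap.adjoint_inner_right, hRD, hsymR, hGx, map_smul,
      inner_smul_right, inner_smul_left, hgstar, inner_opJ] at hdk
    have h1 := ((((hγd k).inv (by rw [hγ₀]; exact inv_ne_zero hκ)).const_add c).ofReal_comp)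
    refine HasDerivWithinAt.congr_deriv h1 ?_
    rw [hγ₀, Complex.ofReal_div, Complex.ofReal_neg, Complex.ofReal_pow, ← hg, hdk,
      hker.deriv_comm ht₀ hX hY, hfam.deriv_omega ht₀ hT, hu, neg_apply, inner_neg_right]
    -- Each term of the Riccati equation at `u k` carries `g ^ 2`, one factor from each resolvent,
    -- and this cancels against the derivative `-d k / g ^ 2` of `γ⁻¹`. The remaining signs are
    -- absorbed by the two derivative identities.
    field_simp
    ring

end Hadamard

end BdryFamily

open BdryFamily in
theorem mainTheorem5 {H K D : Type*}
    [NormedAddCommGroup H] [InnerProductSpace ℂ H] [CompleteSpace H]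
    [NormedAddCommGroup K] [InnerProductSpace ℂ K] [CompleteSpace K]
    [NormedAddCommGroup D] [NormedSpace ℂ D] [CompleteSpace D]
    (A : H →ₗ.[ℂ] H) (j : D →L[ℂ] HPlus A) (T : ℝ → D →L[ℂ] Pair K)
    (Q : ℝ → Pair K →L[ℂ] Pair K) (𝒜 : ℝ → H →ₗ.[ℂ] H) (V : ℝ → H →L[ℂ] H)
    (X Y : ℝ → K →L[ℂ] K)
    (hfam : IsFamily j T Q 𝒜 V) (hker : IsKernelFamily Q X Y)
    (Ht : ℝ → H →ₗ.[ℂ] H) (hHt : ∀ t, Ht t = addBdd (𝒜 t) (V t))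
    (R : ℝ → ℂ → H →L[ℂ] H) (hR : ∀ t ζ, R t ζ = resolv (Ht t) ζ)
    (RD : ℝ → ℂ → H →L[ℂ] D) (hRD : ∀ t ζ, RD t ζ = resolvD j (Ht t) ζ) :
    -- Krein formula
    (∀ t ∈ Set.Icc (0 : ℝ) 1, ∀ s ∈ Set.Icc (0 : ℝ) 1, ∀ ζ : ℂ,
      ζ ∉ spec (Ht t) ∪ spec (Ht s) →
      R t ζ - R s ζ = R t ζ ∘L (V s - V t) ∘L R s ζ
        + (T t ∘L RD t (star ζ))† ∘L opZ (X t) (Y t) (X s) (Y s) ∘L T s ∘L RD s ζ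
        + (T t ∘L RD t (star ζ))† ∘L opJ K ∘L (T t - T s) ∘L RD s ζ) ∧
    ∀ t₀ ∈ Set.Icc (0 : ℝ) 1,
    -- continuity
    (ResolventBounded j 𝒜 t₀ →
      Continuous01 T t₀ → Continuous01 V t₀ →
      Continuous01 X t₀ → Continuous01 Y t₀ →
      ∀ ζ₀ ∉ spec (Ht t₀),
        (∀ᶠ t in 𝓝[Set.Icc 0 1] t₀, ζ₀ ∉ spec (Ht t)) ∧
        Continuous01 (fun t => R t ζ₀) t₀) ∧
    -- differentiability
    (ResolventContinuous j 𝒜 t₀ →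
      ∀ (Tdot : D →L[ℂ] Pair K) (Vdot : H →L[ℂ] H) (Xdot Ydot : K →L[ℂ] K),
      HasDeriv01 T Tdot t₀ → HasDeriv01 V Vdot t₀ →
      HasDeriv01 X Xdot t₀ → HasDeriv01 Y Ydot t₀ →
      -- Riccati equation
      (∀ ζ₀ ∉ spec (Ht t₀),
        (∀ᶠ t in 𝓝[Set.Icc 0 1] t₀, ζ₀ ∉ spec (Ht t)) ∧
        HasDeriv01 (fun t => R t ζ₀)
          (-(R t₀ ζ₀ ∘L Vdot ∘L R t₀ ζ₀)
            + (T t₀ ∘L RD t₀ (star ζ₀))† ∘L (opW (X t₀) (Y t₀))† ∘L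
                (Xdot ∘L (Y t₀)† - Ydot ∘L (X t₀)†) ∘L opW (X t₀) (Y t₀) ∘L T t₀ ∘L RD t₀ ζ₀
            + (T t₀ ∘L RD t₀ (star ζ₀))† ∘L opJ K ∘L Tdot ∘L RD t₀ ζ₀)
          t₀) ∧
      -- Hadamard formula
      ∀ (lam₀ : ℝ) (m : ℕ), 1 ≤ m →
        Module.finrank ℂ (eigSpace (Ht t₀) (lam₀ : ℂ)) = m →
        (∃ r : ℝ, 0 < r ∧ Metric.closedBall (lam₀ : ℂ) r ∩ spec (Ht t₀) = {(lam₀ : ℂ)}) →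
        ∃ (u : Fin m → D) (lam : Fin m → ℝ → ℝ),
          Orthonormal ℂ (fun k => emb j (u k)) ∧
          (∀ k, emb j (u k) ∈ eigSpace (Ht t₀) (lam₀ : ℂ)) ∧
          LabelsEigenvalues Ht t₀ lam₀ lam ∧
          ∀ k, ∃ φ : K,
            φ = opW (X t₀) (Y t₀) (T t₀ (u k)) ∧
            (∀ ψ : K, ((T t₀ (u k)).fst = -((Y t₀)†) ψ ∧ (T t₀ (u k)).snd = ((X t₀)†) ψ) ↔ ψ = φ) ∧
            HasDeriv01 (fun t => (lam k t : ℂ))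
              (inner ℂ (emb j (u k)) (Vdot (emb j (u k)))
                + inner ℂ φ ((X t₀ ∘L Ydot† - Y t₀ ∘L Xdot†) φ)
                + omega (T t₀ (u k)) (Tdot (u k)))
              t₀) := by
  obtain rfl : Ht = fun t => addBdd (𝒜 t) (V t) := funext hHt
  obtain rfl : R = fun t ζ => resolv (addBdd (𝒜 t) (V t)) ζ := funext₂ hR
  obtain rfl : RD = fun t ζ => resolvD j (addBdd (𝒜 t) (V t)) ζ := funext₂ hRD
  refine ⟨fun t ht s hs ζ hζ => ?_, fun t₀ ht₀ => ⟨?_, ?_⟩⟩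
  · rw [Set.mem_union, not_or] at hζ
    exact hfam.krein hker ht hs (notMem_spec.mp hζ.1) (notMem_spec.mp hζ.2)
  · intro hb hT hV hX hY ζ hζ
    obtain ⟨-, h1, h2⟩ := hfam.eventually_mem_resolvSet_and_tendsto hker ht₀ hb hT hV hX hY
      (notMem_spec.mp hζ)
    exact ⟨h1.mono fun t ht => notMem_spec.mpr ht, h2⟩
  · intro hrc T' V' X' Y' hT hV hX hY
    refine ⟨fun ζ hζ => ⟨?_, hfam.hasDeriv01_resolv hker ht₀ hrc hT hV hX hY (notMem_spec.mp hζ)⟩,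
      fun lam₀ m hm1 hm hiso => hfam.hadamard hker ht₀ hrc hT hV hX hY hm1 hm hiso⟩
    obtain ⟨-, h1, -⟩ := hfam.eventually_mem_resolvSet_and_tendsto hker ht₀
      (hrc.tendsto.isBigO_one ℝ) hT.continuousWithinAt hV.continuousWithinAt
      hX.continuousWithinAt hY.continuousWithinAt (notMem_spec.mp hζ)
    exact h1.mono fun t ht => notMem_spec.mpr ht
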